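/- For every $n\ge 1$, contents $1,\dots,n$ of unit size are requested according to point processes $N_{n,1},\dots,N_{n,n}$ on $\mathbb R$, defined on a common probability space $(\Omega,\mathbb P)$. They are mutually independent for each $n$, and each $N_{n,i}=\{t_{n,i}(k):k\in\mathbb Z\}$, with $\cdots<t_{n,i}(0)\le 0<t_{n,i}(1)<\cdots$, is simple, locally finite, stationary and ergodic with intensity $\lambda_{n,i}\in(0,\infty)$. Let $\mathbb P^0_{n,i}$ be the Palm probability associated with $N_{n,i}$, i.e. $\mathbb P^0_{n,i}[A]=\lambda_{n,i}^{-1}\,\mathbb E\big[\sum_{s\in N_{n,i}\cap(0,1]}\mathbf 1_A\circ\theta_s\big]$, where $\theta_s$ moves every point $x$ of every process to $x-s$. Let $G_{n,i}(t)=\mathbb P^0_{n,i}[t_{n,i}(1)\le t]$, let $m_{n,i}=\mathbb E^0_{n,i}[t_{n,i}(1)]$ be its mean, and put $\hat G_{n,i}(t)=m_{n,i}^{-1}\int_0^t(1-G_{n,i}(z))\,dz$ for $t\ge 0$ and $G^*_{n,i}(t)=G_{n,i}(t/\lambda_{n,i})$. All $G_{n,i}$ are assumed continuous, and it is assumed that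 there is a continuous cdf $\Psi$ with support in $[0,\infty)$ and mean $m_\Psi>0$ such that $1-G^*_{n,i}(t)\ge 1-\Psi(t)$ for all $t$ and all $n\ge i\ge 1$. Let $C_n>0$ be cache sizes with $C_n<n$ (for all large $n$) and $C_n\to\infty$. Let $Y_{n,i}(t)=1$ if content $i$ is requested during $[-t,0)$ and $Y_{n,i}(t)=0$ otherwise, $Y_n(t)=\sum_{i=1}^nY_{n,i}(t)$ and $\tau_n=\inf\{t:Y_n(t)\ge C_n\}$. The stationary hit probabilities of content $i$ in the LRU cache of size $C_n$ and in the TTL cache (with reset) with timer $T$ are $$H^{\mathrm{LRU}}_{n,i}=\mathbb P^0_{n,i}[Y_{n,i}(\tau_n)=1],\qquad H^{\mathrm{TTL}}_{n,i}(T)=\mathbb P^0_{n,i}[Y_{n,i}(T)=1].$$ Let the characteristic time $T_n\ge 0$ satisfy $C_n=\sum_{i=1}^n\hat G_{n,i}(T_n)$ (for all large $n$). Let $p_{n,i}=\lambda_{n,i}/\sum_{j=1}^n\lambda_{n,j}$, and let $\bar P_n(k)=\sum_{l=k+1}^np_{n,\sigma_l}$, where $p_{n,\sigma_1}\ge\dots\ge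 p_{n,\sigma_n}$ is the decreasing rearrangement of $p_{n,1},\dots,p_{n,n}$. Assume: (C1) there is $\beta_1\in(0,m_\Psi)$ such that $C_n\le\beta_1 n$ for all sufficiently large $n$; (P1) there are constants $\kappa_1\in(1/m_\Psi,1/\beta_1)$, $\kappa_2\in[0,1)$ and $\gamma\in(0,1)$ such that $\bar P_n(\lceil\kappa_1C_n\rceil)>\gamma\,\bar P_n(\lfloor\kappa_2C_n\rfloor)$ for all sufficiently large $n$. Call a family $\mathscr F$ of functions on $\mathbb R$ equicontinuous if for every $\epsilon>0$ there is $\delta>0$ such that $|x_1-x_2|<\delta$ implies $|f(x_1)-f(x_2)|<\epsilon$ for every $f\in\mathscr F$. Then: (a) for every fixed $i\ge1$ such that (R1) $\{G^*_{n,i}:n\ge i\}$ is equicontinuous, $$\big|H^{\mathrm{LRU}}_{n,i}-H^{\mathrm{TTL}}_{n,i}(T_n)\big|\to0\quad\text{as }n\to\infty;$$ (b) if (R2) $\{G^*_{n,i}:n\ge i\ge1\}$ is equicontinuous, then $$\max_{1\le i\le n}\big|H^{\mathrm{LRU}}_{n,i}-H^{\mathrm{TTL}}_{n,i}(T_n)\big|\to0\quad\text{as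 }n\to\infty.$$ -/

import Mathlib

open MeasureTheory ProbabilityTheory Filter Topology Set
open scoped ENNReal

noncomputable section

namespace RequestModel

/-- A locally finite set of points on the line: a realization of a simple point process. -/
structure PointConfig where
  points : Set ℝ
  locallyFinite : ∀ a b : ℝ, (points ∩ Icc a b).Finite

/-- The sigma-algebra generated by the counting maps `φ ↦ #(φ ∩ B)`, `B` Borel. -/
instance : MeasurableSpace PointConfig :=
  ⨆ B : {B : Set ℝ // MeasurableSet B},
    MeasurableSpace.comap (fun φ : PointConfig => (φ.points ∩ B.1).encard) ⊤

/-- The configuration seen from `s`: every point `x` is moved to `x - s`. -/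
def PointConfig.shift (s : ℝ) (φ : PointConfig) : PointConfig where
  points := {x | x + s ∈ φ.points}
  locallyFinite a b := by
    refine ((φ.locallyFinite (a + s) (b + s)).preimage
      (f := fun x => x + s) (add_left_injective s).injOn).subset ?_
    rintro x ⟨hx, ha, hb⟩
    exact ⟨hx, by linarith, by linarith⟩

/-- The first point `t(1) > 0` (equal to `⊤` if there is none). -/
def PointConfig.nextPoint (φ : PointConfig) : EReal :=
  sInf {y : EReal | ∃ x ∈ φ.points, 0 < x ∧ y = (x : EReal)}

/-- There is a point in `[-t, 0)`. -/
def PointConfig.RequestedWithin (φ : PointConfig) (t : EReal) : Prop :=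
  ∃ x ∈ φ.points, -t ≤ (x : EReal) ∧ x < 0

section Quantities

variable {Ω : Type*} [MeasurableSpace Ω]

/-- Stationarity: the law is invariant under all shifts. -/
def IsStationary (P : Measure Ω) (M : Ω → PointConfig) : Prop :=
  ∀ s : ℝ, P.map (fun ω => (M ω).shift s) = P.map M

/-- Ergodicity: shift-invariant events of the process have probability `0` or `1`. -/
def IsErgodic (P : Measure Ω) (M : Ω → PointConfig) : Prop :=
  ∀ A : Set PointConfig, MeasurableSet A → (∀ s : ℝ, PointConfig.shift s ⁻¹' A = A) →
    P (M ⁻¹' A) = 0 ∨ P (M ⁻¹' A) = 1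

/-- The intensity: expected number of points in `(0, 1]`. -/
def intensity (P : Measure Ω) (M : Ω → PointConfig) : ℝ≥0∞ :=
  ∫⁻ ω, (((M ω).points ∩ Ioc 0 1).encard : ℝ≥0∞) ∂P

/-- `M` is a stationary ergodic simple point process with intensity in `(0, ∞)`. -/
structure IsRequestProcess (P : Measure Ω) (M : Ω → PointConfig) : Prop where
  measurable : Measurable M
  stationary : IsStationary P M
  ergodic : IsErgodic P M
  intensity_pos : 0 < intensity P M
  intensity_lt_top : intensity P M < ⊤

/-! In the next definitions `N j`, for `1 ≤ j ≤ n`, is the request process of content `j`. -/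

/-- The request rate `λ_i` as a real number. -/
def rate (P : Measure Ω) (N : ℕ → Ω → PointConfig) (i : ℕ) : ℝ :=
  (intensity P (N i)).toReal

/-- Palm expectation associated with the process `N i`, of a functional of all processes:
`λ_i⁻¹ 𝔼[∑_{s ∈ N_i ∩ (0,1]} f(θ_s N)]`. -/
def palmExp (P : Measure Ω) (N : ℕ → Ω → PointConfig) (i : ℕ)
    (f : (ℕ → PointConfig) → ℝ≥0∞) : ℝ≥0∞ :=
  (∫⁻ ω, ∑' s : ↥((N i ω).points ∩ Ioc 0 1), f (fun j => (N j ω).shift s) ∂P)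
    / intensity P (N i)

/-- Palm probability associated with the process `N i`. -/
def palmProb (P : Measure Ω) (N : ℕ → Ω → PointConfig) (i : ℕ)
    (A : Set (ℕ → PointConfig)) : ℝ :=
  (palmExp P N i (A.indicator 1)).toReal

/-- The inter-request cdf `G_i(t) = ℙ⁰_i[t_i(1) ≤ t]`. -/
def interCDF (P : Measure Ω) (N : ℕ → Ω → PointConfig) (i : ℕ) (t : ℝ) : ℝ :=
  palmProb P N i {φ | (φ i).nextPoint ≤ (t : EReal)}

/-- The mean inter-request time `𝔼⁰_i[t_i(1)]`. -/
def interMean (P : Measure Ω) (N : ℕ → Ω → PointConfig) (i : ℕ) : ℝ :=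
  (palmExp P N i (fun φ => (φ i).nextPoint.toENNReal)).toReal

/-- The standardized cdf `G*_i(t) = G_i(t / λ_i)`. -/
def stdCDF (P : Measure Ω) (N : ℕ → Ω → PointConfig) (i : ℕ) (t : ℝ) : ℝ :=
  interCDF P N i (t / rate P N i)

/-- The distribution `Ĝ_i(t) = m⁻¹ ∫_0^t (1 - G_i(z)) dz`, with `m` the mean of `G_i`. -/
def hatCDF (P : Measure Ω) (N : ℕ → Ω → PointConfig) (i : ℕ) (t : ℝ) : ℝ :=
  (interMean P N i)⁻¹ * ∫ z in (0 : ℝ)..t, (1 - interCDF P N i z)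

/-- The popularity `p_i = λ_i / ∑_j λ_j` of content `i` among the contents `1, …, n`. -/
def popularity (P : Measure Ω) (N : ℕ → Ω → PointConfig) (n i : ℕ) : ℝ :=
  rate P N i / ∑ j ∈ Finset.Icc 1 n, rate P N j

/-- The tail `∑_{k < l ≤ n} p_{σ_l}` of the popularities `p 1, …, p n` arranged in decreasing
order `p_{σ_1} ≥ ⋯ ≥ p_{σ_n}`. The index `l : Fin n` stands for the rank `l + 1`, and the
value `σ l : Fin n` stands for the content `σ l + 1`. -/
def tailPopularity (p : ℕ → ℝ) (n k : ℕ) : ℝ :=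
  let σ : Equiv.Perm (Fin n) := Tuple.sort (fun j : Fin n => -p (j + 1))
  ∑ l ∈ Finset.univ.filter (fun l : Fin n => k ≤ (l : ℕ)), p (σ l + 1)

/-- `Y_n(t)`: the number of contents among `1, …, n` requested in `[-t, 0)`. -/
def distinctCount (n : ℕ) (φ : ℕ → PointConfig) (t : EReal) : ℕ :=
  {j ∈ Set.Icc 1 n | (φ j).RequestedWithin t}.ncard

/-- `τ_n = inf {t ≥ 0 : Y_n(t) ≥ C}` (equal to `⊤` if there is no such `t`). -/
def fillTime (n : ℕ) (C : ℝ) (φ : ℕ → PointConfig) : EReal :=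
  sInf {y : EReal | ∃ t : ℝ, 0 ≤ t ∧ C ≤ distinctCount n φ t ∧ y = (t : EReal)}

/-- Stationary hit probability of content `i` in an LRU cache of size `C`. -/
def hitLRU (P : Measure Ω) (N : ℕ → Ω → PointConfig) (n : ℕ) (C : ℝ) (i : ℕ) : ℝ :=
  palmProb P N i {φ | (φ i).RequestedWithin (fillTime n C φ)}

/-- Stationary hit probability of content `i` in a TTL cache (with reset) with timer `T`. -/
def hitTTL (P : Measure Ω) (N : ℕ → Ω → PointConfig) (T : ℝ) (i : ℕ) : ℝ :=
  palmProb P N i {φ | (φ i).RequestedWithin (T : EReal)}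

/-- `T` is a characteristic time of an LRU cache of size `C`: `C = ∑_{i=1}^n Ĝ_i(T)`. -/
def IsCharacteristicTime (P : Measure Ω) (N : ℕ → Ω → PointConfig) (n : ℕ) (C T : ℝ) : Prop :=
  0 ≤ T ∧ C = ∑ i ∈ Finset.Icc 1 n, hatCDF P N i T

/-- The family `{G*_{n,i} : n ≥ i}` of standardized cdfs of content `i`. -/
def stdFamilyOf (P : Measure Ω) (N : ℕ → ℕ → Ω → PointConfig) (i : ℕ) : Set (ℝ → ℝ) :=
  {F | ∃ n, i ≤ n ∧ F = stdCDF P (N n) i}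

/-- The family `{G*_{n,i} : n ≥ i ≥ 1}` of all standardized cdfs. -/
def stdFamily (P : Measure Ω) (N : ℕ → ℕ → Ω → PointConfig) : Set (ℝ → ℝ) :=
  ⋃ i ∈ Set.Ici 1, stdFamilyOf P N i

end Quantities

end RequestModel

end

open RequestModel

/-! Seen from a typical request for content `i`, the fill time `τ_n` concentrates around `T_n`, so
the LRU cache behaves like a TTL cache with timer `T_n`.

Palm calculus identifies the quantities. The inversion formula gives `P[request in [-t, 0)] =
Ĝ_i(t)` and `m_i = 1 / λ_i` (`measureReal_requestedWithin`, `interMean_eq`); mass transport shows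
that backward and forward recurrence times have the same Palm law, so that the TTL hit probability
is `G_i(T)` (`hitTTL_eq_interCDF`). Write `K(t) = ∑ Ĝ_j(t)`, so that `K(T_n) = C_n`.

Apart from content `i`, which changes it by at most one, `Y_n(t)` is a sum of independent indicators
whose law is unaffected by viewing it from a request of `i`. Its variance is at most `K(t)`, so
Chebyshev applies. If `K(T₁)` and `K(T₂)` lie on either side of `C` with a gap above `a + 1`, then
`T₁ ≤ τ ≤ T₂` up to small probability, and the hit probabilities differ by at most `G_i(T₂) -
G_i(T₁) + K(T₂) / a²` (`abs_hitLRU_sub_hitTTL_le`).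

Take `T₁ = T(1 - x)` and `T₂ = T(1 + x)`. Contents with `λ_j T ≥ a` each contribute at least `1 /
κ₁` to `K(T) = C`, hence number at most `κ₁ C`. By (P1) the remaining contents satisfy `∑ λ_j T ≥
γ(1 - κ₂) C` (`mul_le_sum_moderate`), and for them `1 - G_j` is bounded below by `Ψ` near `T`. So
`K` moves by at least `δ C` on either side of `T`, and the Chebyshev error is `O(1 / C)`.
Equicontinuity makes `G*_i(u(1 + x)) - G*_i(u(1 - x))` small uniformly in `u = λ_i T`: large `u` is
covered by a Markov-type bound (`exists_log_modulus`). Fixing `x` first and then letting `C_n → ∞`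
proves both claims. -/

namespace RequestModel

/-! ### Configurations as counting measures, and measurability -/

namespace PointConfig

theorem countable_points (φ : PointConfig) : φ.points.Countable := by
  have h : φ.points = ⋃ n : ℕ, φ.points ∩ Icc (-(n : ℝ)) n := by
    ext x
    simp only [mem_iUnion, mem_inter_iff, mem_Icc, exists_and_left, iff_self_and]
    intro _
    obtain ⟨n, hn⟩ := exists_nat_ge |x|
    exact ⟨n, abs_le.1 hn⟩
  rw [h]
  exact countable_iUnion fun n => (φ.locallyFinite _ _).countable

/-- The counting measure of a configuration. -/
noncomputable def count (φ : PointConfig) : Measure ℝ := Measure.count.restrict φ.points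

theorem count_apply (φ : PointConfig) {B : Set ℝ} (hB : MeasurableSet B) :
    φ.count B = ((φ.points ∩ B).encard : ℝ≥0∞) := by
  rw [count, Measure.restrict_apply hB, inter_comm,
    Measure.count_apply (φ.countable_points.measurableSet.inter hB)]

theorem measurable_count_apply {B : Set ℝ} (hB : MeasurableSet B) :
    Measurable fun φ : PointConfig => φ.count B := by
  have h : @Measurable PointConfig ℕ∞ _ ⊤ fun φ : PointConfig => (φ.points ∩ B).encard := by
    rw [measurable_iff_comap_le]
    exact le_iSup (fun B : {B : Set ℝ // MeasurableSet B} =>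
      MeasurableSpace.comap (fun φ : PointConfig => (φ.points ∩ B.1).encard) ⊤) ⟨B, hB⟩
  simp_rw [count_apply _ hB]
  exact (@measurable_from_top ℕ∞ ℝ≥0∞ _ _).comp h

theorem measurable_iff {α : Type*} [MeasurableSpace α] {M : α → PointConfig} :
    Measurable M ↔ ∀ B, MeasurableSet B → Measurable fun a => (M a).count B := by
  refine ⟨fun h B hB => (measurable_count_apply hB).comp h, fun h => ?_⟩
  rw [measurable_iff_comap_le]
  simp only [instMeasurableSpacePointConfig, MeasurableSpace.comap_iSup, iSup_le_iff,
    MeasurableSpace.comap_comp]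
  rintro ⟨B, hB⟩ _ ⟨s, -, rfl⟩
  have := h B hB
  simp_rw [count_apply _ hB] at this
  -- The coercion of `ℕ∞` into `ℝ≥0∞` is injective, so `s` is recovered from its image, a countable
  -- and hence measurable set.
  have hs : (Function.comp (fun φ : PointConfig => (φ.points ∩ B).encard) M) ⁻¹' s =
      (fun a => (((M a).points ∩ B).encard : ℝ≥0∞)) ⁻¹' ((fun k : ℕ∞ => (k : ℝ≥0∞)) '' s) := by
    ext a
    simp
  rw [hs]
  exact this ((Set.to_countable s).image _).measurableSet

/-- The counting measures as a kernel. -/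
noncomputable def countKernel : Kernel PointConfig ℝ where
  toFun := count
  measurable' := Measure.measurable_of_measurable_coe _ fun _ hB => measurable_count_apply hB

theorem count_Ioc_lt_top (φ : PointConfig) (a b : ℝ) : φ.count (Ioc a b) < ⊤ := by
  rw [count_apply _ measurableSet_Ioc]
  have := ((φ.locallyFinite a b).subset (inter_subset_inter_right _ Ioc_subset_Icc_self))
  rw [← this.cast_ncard_eq]
  simp

theorem iUnion_Ioc_int : ⋃ k : ℤ, Ioc (k : ℝ) (k + 1) = univ := by
  simpa using iUnion_Ioc_add_intCast (0 : ℝ)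

theorem pairwise_disjoint_Ioc_int : Pairwise (Function.onFun Disjoint fun k : ℤ => Ioc (k : ℝ) (k + 1)) := by
  simpa using pairwise_disjoint_Ioc_add_intCast (0 : ℝ)

/-- The cells `(k, k + 1]` and the number `m` of points in each cut the kernel into countably many
pieces, the piece `(k, m)` having mass at most `m`. Joint measurability and Tonelli rest on this. -/
instance : IsSFiniteKernel countKernel := by
  have hms (k : ℤ) (m : ℕ) : MeasurableSet {φ : PointConfig | φ.count (Ioc (k : ℝ) (k + 1)) = m} :=
    measurable_count_apply measurableSet_Ioc (measurableSet_singleton _)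
  classical
  let K : ℤ × ℕ → Kernel PointConfig ℝ := fun q =>
    Kernel.piecewise (hms q.1 q.2) (countKernel.restrict (measurableSet_Ioc (a := (q.1 : ℝ)) (b := q.1 + 1))) 0
  have hK (q) : IsFiniteKernel (K q) := by
    refine ⟨⟨q.2, by simp, fun φ => ?_⟩⟩
    simp only [K, Kernel.piecewise_apply, Kernel.restrict_apply]
    split_ifs with h
    · rw [Measure.restrict_apply_univ]
      exact h.le
    · simp
  have hsum : countKernel = Kernel.sum K := by
    ext φ B hB
    rw [Kernel.sum_apply' _ _ hB, ENNReal.summable.tsum_prod' fun _ => ENNReal.summable]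
    have h1 : φ.count B = ∑' k : ℤ, φ.count (B ∩ Ioc (k : ℝ) (k + 1)) := by
      rw [← measure_iUnion (fun i j hij => ((pairwise_disjoint_Ioc_int hij).mono
        inter_subset_right inter_subset_right)) (fun k => hB.inter measurableSet_Ioc),
        ← inter_iUnion, iUnion_Ioc_int, inter_univ]
    change φ.count B = _
    rw [h1]
    refine tsum_congr fun k => ?_
    obtain ⟨m, hm⟩ : ∃ m : ℕ, φ.count (Ioc (k : ℝ) (k + 1)) = m := by
      have := φ.count_Ioc_lt_top k (k + 1)
      rw [count_apply _ measurableSet_Ioc] at this ⊢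
      obtain ⟨m, hm⟩ := ENat.ne_top_iff_exists.1 (by simpa using this.ne : (φ.points ∩ Ioc (k : ℝ) (k + 1)).encard ≠ ⊤)
      exact ⟨m, by rw [← hm]; simp⟩
    rw [tsum_eq_single m]
    · simp only [K, Kernel.piecewise_apply, Kernel.restrict_apply, mem_ofPred_eq, hm, if_true]
      rw [Measure.restrict_apply hB]
      rfl
    · intro m' hm'
      simp only [K, Kernel.piecewise_apply, mem_ofPred_eq, hm]
      rw [if_neg (by exact_mod_cast hm'.symm)]
      simp
  rw [hsum]
  infer_instance

instance (φ : PointConfig) : SFinite φ.count :=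
  inferInstanceAs (SFinite (countKernel φ))

theorem measurable_lintegral_count {α : Type*} [MeasurableSpace α] {M : α → PointConfig}
    (hM : Measurable M) {f : α → ℝ → ℝ≥0∞} (hf : Measurable (Function.uncurry f)) :
    Measurable fun a => ∫⁻ x, f a x ∂(M a).count :=
  hf.lintegral_kernel_prod_right (κ := countKernel.comap M hM)

theorem measurable_setLIntegral_count {α : Type*} [MeasurableSpace α] {M : α → PointConfig}
    (hM : Measurable M) {f : α → ℝ → ℝ≥0∞} (hf : Measurable (Function.uncurry f))
    {B : Set ℝ} (hB : MeasurableSet B) :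
    Measurable fun a => ∫⁻ x in B, f a x ∂(M a).count :=
  hf.lintegral_kernel_prod_right (κ := (countKernel.comap M hM).restrict hB)

theorem shift_shift (φ : PointConfig) (s t : ℝ) : (φ.shift s).shift t = φ.shift (s + t) := by
  simp only [shift, mk.injEq, mem_ofPred_eq]
  ext x
  simp [add_assoc, add_comm t s]

theorem mem_shift {φ : PointConfig} {s x : ℝ} : x ∈ (φ.shift s).points ↔ x + s ∈ φ.points := Iff.rfl

theorem lintegral_count_shift (φ : PointConfig) (s : ℝ) (f : ℝ → ℝ≥0∞) :
    ∫⁻ x, f x ∂(φ.shift s).count = ∫⁻ x, f (x - s) ∂φ.count := by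
  have h : (φ.shift s).count = φ.count.map (MeasurableEquiv.subRight s) := by
    ext B hB
    rw [MeasurableEquiv.map_apply, count_apply _ hB, count_apply _
      ((MeasurableEquiv.subRight s).measurable hB)]
    congr 1
    rw [← ((add_left_injective s).injOn).encard_image]
    congr 1
    ext x
    simp only [mem_image, mem_inter_iff, mem_shift, mem_preimage]
    constructor
    · rintro ⟨y, ⟨h1, h2⟩, rfl⟩
      exact ⟨h1, by change y + s - s ∈ B; simpa using h2⟩
    · rintro ⟨h1, h2⟩
      exact ⟨x - s, ⟨by simpa using h1, h2⟩, by simp⟩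
  rw [h, lintegral_map_equiv]
  rfl

theorem measurable_shift : Measurable fun p : ℝ × PointConfig => p.2.shift p.1 := by
  rw [measurable_iff]
  intro B hB
  have h (p : ℝ × PointConfig) : (p.2.shift p.1).count B =
      ∫⁻ x, B.indicator 1 (x - p.1) ∂p.2.count := by
    rw [← lintegral_count_shift, lintegral_indicator_one hB]
  simp_rw [h]
  refine measurable_lintegral_count measurable_snd ?_
  exact (measurable_one.indicator hB).comp (measurable_snd.sub (measurable_fst.comp measurable_fst))

theorem measurable_shift_const (s : ℝ) : Measurable (shift s) :=
  measurable_shift.comp (measurable_const.prodMk measurable_id)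

theorem tsum_points (φ : PointConfig) (B : Set ℝ) (hB : MeasurableSet B) (f : ℝ → ℝ≥0∞) :
    ∑' s : ↥(φ.points ∩ B), f s = ∫⁻ x in B, f x ∂φ.count := by
  rw [count, Measure.restrict_restrict hB, inter_comm B,
    lintegral_countable _ (φ.countable_points.mono inter_subset_left)]
  simp

end PointConfig

/-! ### Stationarity and Campbell's formula -/

open PointConfig

theorem lintegral_shift_eq {Q : Measure PointConfig} (hQ : ∀ s, Q.map (shift s) = Q) (s : ℝ)
    {f : PointConfig → ℝ≥0∞} (hf : Measurable f) : ∫⁻ φ, f (φ.shift s) ∂Q = ∫⁻ φ, f φ ∂Q := by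
  conv_rhs => rw [← hQ s, lintegral_map hf (measurable_shift_const s)]

/-- Moving the origin to `v` changes the position of each point by `-v` but not the configuration
seen from it. -/
theorem lintegral_count_shift_eq {Q : Measure PointConfig}
    (hQ : ∀ s, Q.map (shift s) = Q) (v : ℝ) {h : ℝ → PointConfig → ℝ≥0∞}
    (hh : Measurable (Function.uncurry h)) :
    ∫⁻ φ, ∫⁻ x, h x (φ.shift x) ∂φ.count ∂Q =
      ∫⁻ φ, ∫⁻ x, h (x - v) (φ.shift x) ∂φ.count ∂Q := by
  have hm : Measurable fun φ : PointConfig => ∫⁻ x, h x (φ.shift x) ∂φ.count :=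
    measurable_lintegral_count measurable_id
      (hh.comp (measurable_snd.prodMk (measurable_shift.comp measurable_swap)))
  rw [← lintegral_shift_eq hQ v hm]
  refine lintegral_congr fun φ => ?_
  rw [lintegral_count_shift]
  refine lintegral_congr fun x => ?_
  rw [shift_shift, add_sub_cancel]

/-- **Campbell's formula** for a stationary point process. -/
theorem lintegral_count_shift_eq_palm {Q : Measure PointConfig} [SFinite Q]
    (hQ : ∀ s, Q.map (shift s) = Q) {h : ℝ → PointConfig → ℝ≥0∞}
    (hh : Measurable (Function.uncurry h)) :
    ∫⁻ φ, ∫⁻ x, h x (φ.shift x) ∂φ.count ∂Q =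
      ∫⁻ s, ∫⁻ φ, ∫⁻ x in Ioc 0 1, h s (φ.shift x) ∂φ.count ∂Q := by
  let e : ℝ → ℝ≥0∞ := (Ioc (0 : ℝ) 1).indicator 1
  have he : Measurable e := measurable_one.indicator measurableSet_Ioc
  have heI (f : ℝ → ℝ≥0∞) (μ : Measure ℝ) : ∫⁻ x in Ioc 0 1, f x ∂μ = ∫⁻ x, e x * f x ∂μ := by
    rw [← lintegral_indicator measurableSet_Ioc]
    refine lintegral_congr fun x => ?_
    by_cases hx : x ∈ Ioc (0 : ℝ) 1 <;> simp [e, hx]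
  -- By stationarity the unit window `(0, 1]` may be replaced by `(s, s + 1]`.
  have key (s : ℝ) : ∫⁻ φ, ∫⁻ x in Ioc 0 1, h s (φ.shift x) ∂φ.count ∂Q =
      ∫⁻ φ, ∫⁻ x, e (x - s) * h s (φ.shift x) ∂φ.count ∂Q := by
    simp_rw [heI]
    exact lintegral_count_shift_eq hQ s (h := fun x φ => e x * h s φ)
      ((he.comp measurable_fst).mul (hh.comp (measurable_const.prodMk measurable_snd)))
  have hsh : Measurable fun p : (ℝ × PointConfig) × ℝ => p.1.2.shift p.2 :=
    measurable_shift.comp (measurable_snd.prodMk (measurable_snd.comp measurable_fst))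
  have hsub : Measurable fun p : (ℝ × PointConfig) × ℝ => p.2 - p.1.1 :=
    measurable_snd.sub (measurable_fst.comp measurable_fst)
  have hms : Measurable fun p : (ℝ × PointConfig) × ℝ =>
      e (p.2 - p.1.1) * h p.1.1 (p.1.2.shift p.2) :=
    (he.comp hsub).mul (hh.comp ((measurable_fst.comp measurable_fst).prodMk hsh))
  have hms' : Measurable fun p : (ℝ × PointConfig) × ℝ =>
      e p.1.1 * h (p.2 - p.1.1) (p.1.2.shift p.2) :=
    (he.comp (measurable_fst.comp measurable_fst)).mul (hh.comp (hsub.prodMk hsh))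
  have swap {g : ℝ → PointConfig → ℝ → ℝ≥0∞}
      (hg : Measurable fun p : (ℝ × PointConfig) × ℝ => g p.1.1 p.1.2 p.2) :
      ∫⁻ v, ∫⁻ φ, ∫⁻ x, g v φ x ∂φ.count ∂Q = ∫⁻ φ, ∫⁻ x, (∫⁻ v, g v φ x) ∂φ.count ∂Q := by
    rw [lintegral_lintegral_swap]
    · refine lintegral_congr fun φ => ?_
      rw [lintegral_lintegral_swap]
      exact (hg.comp ((measurable_fst.prodMk measurable_const).prodMk measurable_snd)).aemeasurable
    · exact (measurable_lintegral_count (M := fun p : ℝ × PointConfig => p.2)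
        (f := fun p => g p.1 p.2) measurable_snd hg).aemeasurable
  -- Average the invariance over `v ∈ (0, 1]`, then substitute `s = x - v` inside.
  calc ∫⁻ φ, ∫⁻ x, h x (φ.shift x) ∂φ.count ∂Q
      = ∫⁻ v, e v * ∫⁻ φ, ∫⁻ x, h (x - v) (φ.shift x) ∂φ.count ∂Q := by
        simp_rw [← fun v => lintegral_count_shift_eq hQ v hh]
        rw [← heI]
        simp
    _ = ∫⁻ v, ∫⁻ φ : PointConfig, ∫⁻ x, e v * h (x - v) (φ.shift x) ∂φ.count ∂Q := by
        refine lintegral_congr fun v => ?_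
        have hv : e v ≠ ⊤ := by
          by_cases hv : v ∈ Ioc (0 : ℝ) 1 <;> simp [e, hv]
        rw [← lintegral_const_mul' _ _ hv]
        refine lintegral_congr fun φ => ?_
        rw [lintegral_const_mul' _ _ hv]
    _ = ∫⁻ φ : PointConfig, ∫⁻ x, (∫⁻ v, e v * h (x - v) (φ.shift x)) ∂φ.count ∂Q := swap hms'
    _ = ∫⁻ φ : PointConfig, ∫⁻ x, (∫⁻ s, e (x - s) * h s (φ.shift x)) ∂φ.count ∂Q := by
        refine lintegral_congr fun φ => lintegral_congr fun x => ?_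
        rw [← lintegral_sub_left_eq_self (fun v => e v * h (x - v) (φ.shift x)) x]
        simp
    _ = _ := by
        simp_rw [key]
        exact (swap hms).symm

/-! ### First and last points of a configuration -/

namespace PointConfig

theorem count_eq_zero_iff (φ : PointConfig) {B : Set ℝ} (hB : MeasurableSet B) :
    φ.count B = 0 ↔ φ.points ∩ B = ∅ := by
  rw [count_apply _ hB]
  simp

theorem count_ne_zero_iff (φ : PointConfig) {B : Set ℝ} (hB : MeasurableSet B) :
    φ.count B ≠ 0 ↔ (φ.points ∩ B).Nonempty := by
  rw [Ne, count_eq_zero_iff _ hB, nonempty_iff_ne_empty]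

theorem measurableSet_count_eq_zero {α : Type*} [MeasurableSpace α] {M : α → PointConfig}
    (hM : Measurable M) {B : α → Set ℝ} (hB : MeasurableSet {p : α × ℝ | p.2 ∈ B p.1}) :
    MeasurableSet {a | (M a).count (B a) = 0} := by
  have h (a : α) : (M a).count (B a) =
      ∫⁻ x, {p : α × ℝ | p.2 ∈ B p.1}.indicator 1 (a, x) ∂(M a).count := by
    exact (lintegral_indicator_one (measurable_prodMk_left hB)).symm
  simp_rw [h]
  exact (measurable_lintegral_count hM (f := fun a x => {p : α × ℝ | p.2 ∈ B p.1}.indicator 1 (a, x))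
    (measurable_one.indicator hB)) (measurableSet_singleton 0)

/-- A unique point selected from `φ ∩ B` whenever this set is nonempty. -/
theorem setLIntegral_count_unique (φ : PointConfig) {B : Set ℝ} (hB : MeasurableSet B)
    {D : ℝ → Prop} (hD : (φ.points ∩ B).Nonempty → ∃! y, y ∈ φ.points ∩ B ∧ D y) :
    ∫⁻ y in B, {y | D y}.indicator 1 y ∂φ.count = {φ : PointConfig | φ.count B ≠ 0}.indicator 1 φ := by
  rw [← tsum_points φ B hB]
  by_cases h : (φ.points ∩ B).Nonempty
  · obtain ⟨y, ⟨hy, hDy⟩, hu⟩ := hD h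
    rw [indicator_of_mem (by exact (count_ne_zero_iff φ hB).2 h), tsum_eq_single ⟨y, hy⟩]
    · simp [hDy]
    · rintro ⟨z, hz⟩ hne
      refine indicator_of_notMem (fun hDz => hne ?_) _
      exact Subtype.ext (hu z ⟨hz, hDz⟩)
  · rw [indicator_of_notMem (by simpa using (not_iff_not.2 (count_ne_zero_iff φ hB)).2 h)]
    rw [not_nonempty_iff_eq_empty] at h
    rw [h]
    simp

theorem existsUnique_last (φ : PointConfig) {B : Set ℝ} (b : ℝ) (hb : B ⊆ Iic b)
    (h : (φ.points ∩ B).Nonempty) :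
    ∃! y, y ∈ φ.points ∩ B ∧ φ.points ∩ (B ∩ Ioi y) = ∅ := by
  obtain ⟨x, hx, hxB⟩ := h
  have hfin : (φ.points ∩ B ∩ Ici x).Finite :=
    (φ.locallyFinite x b).subset fun y hy => ⟨hy.1.1, hy.2, hb hy.1.2⟩
  obtain ⟨y, hy, hmax⟩ := hfin.exists_maximalFor id _ ⟨x, ⟨hx, hxB⟩, le_refl x⟩
  refine ⟨y, ⟨hy.1, ?_⟩, ?_⟩
  · rw [eq_empty_iff_forall_notMem]
    rintro z ⟨hz, hzB, hyz : y < z⟩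
    exact absurd (hmax ⟨⟨hz, hzB⟩, (hy.2 : x ≤ y).trans hyz.le⟩ hyz.le) (not_le.2 hyz)
  · rintro z ⟨hz, hze⟩
    rw [eq_empty_iff_forall_notMem] at hze
    have h1 : y ≤ z := by
      by_contra! hzy
      exact hze y ⟨hy.1.1, hy.1.2, hzy⟩
    exact le_antisymm (hmax ⟨hz, (hy.2 : x ≤ y).trans h1⟩ h1) h1

theorem existsUnique_first (φ : PointConfig) {B : Set ℝ} (b : ℝ) (hb : B ⊆ Ici b)
    (h : (φ.points ∩ B).Nonempty) :
    ∃! y, y ∈ φ.points ∩ B ∧ φ.points ∩ (B ∩ Iio y) = ∅ := by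
  obtain ⟨x, hx, hxB⟩ := h
  have hfin : (φ.points ∩ B ∩ Iic x).Finite :=
    (φ.locallyFinite b x).subset fun y hy => ⟨hy.1.1, hb hy.1.2, hy.2⟩
  obtain ⟨y, hy, hmin⟩ := hfin.exists_minimalFor id _ ⟨x, ⟨hx, hxB⟩, le_refl x⟩
  refine ⟨y, ⟨hy.1, ?_⟩, ?_⟩
  · rw [eq_empty_iff_forall_notMem]
    rintro z ⟨hz, hzB, hyz : z < y⟩
    exact absurd (hmin ⟨⟨hz, hzB⟩, hyz.le.trans (hy.2 : y ≤ x)⟩ hyz.le) (not_le.2 hyz)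
  · rintro z ⟨hz, hze⟩
    rw [eq_empty_iff_forall_notMem] at hze
    have h1 : z ≤ y := by
      by_contra! hzy
      exact hze y ⟨hy.1.1, hy.1.2, hzy⟩
    exact le_antisymm h1 (hmin ⟨hz, h1.trans (hy.2 : y ≤ x)⟩ h1)

theorem setLIntegral_count_last (φ : PointConfig) {B : Set ℝ} (hB : MeasurableSet B) (b : ℝ)
    (hb : B ⊆ Iic b) :
    ∫⁻ y in B, {y | φ.count (B ∩ Ioi y) = 0}.indicator 1 y ∂φ.count =
      {φ : PointConfig | φ.count B ≠ 0}.indicator 1 φ := by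
  refine setLIntegral_count_unique φ hB fun h => ?_
  simp_rw [count_eq_zero_iff φ (hB.inter measurableSet_Ioi)]
  exact existsUnique_last φ b hb h

theorem setLIntegral_count_first (φ : PointConfig) {B : Set ℝ} (hB : MeasurableSet B) (b : ℝ)
    (hb : B ⊆ Ici b) :
    ∫⁻ y in B, {y | φ.count (B ∩ Iio y) = 0}.indicator 1 y ∂φ.count =
      {φ : PointConfig | φ.count B ≠ 0}.indicator 1 φ := by
  refine setLIntegral_count_unique φ hB fun h => ?_
  simp_rw [count_eq_zero_iff φ (hB.inter measurableSet_Iio)]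
  exact existsUnique_first φ b hb h

theorem count_shift_apply (φ : PointConfig) (s : ℝ) {B : Set ℝ} (hB : MeasurableSet B) :
    (φ.shift s).count B = φ.count ((fun x => x - s) ⁻¹' B) := by
  rw [← lintegral_indicator_one hB, lintegral_count_shift]
  exact lintegral_indicator_one (hB.preimage (measurable_id.sub_const s))

theorem nextPoint_le_iff (φ : PointConfig) (t : ℝ) :
    φ.nextPoint ≤ t ↔ φ.count (Ioc 0 t) ≠ 0 := by
  rw [count_ne_zero_iff φ measurableSet_Ioc]
  constructor
  · intro h
    by_contra hne
    rw [not_nonempty_iff_eq_empty, eq_empty_iff_forall_notMem] at hne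
    have hfin : (φ.points ∩ Ioc t (t + 1)).Finite :=
      (φ.locallyFinite t (t + 1)).subset (inter_subset_inter_right _ Ioc_subset_Icc_self)
    obtain ⟨r, hr, hrt⟩ : ∃ r > t, ∀ x ∈ φ.points, 0 < x → r ≤ x := by
      by_cases he : (φ.points ∩ Ioc t (t + 1)).Nonempty
      · obtain ⟨y, hy, hmin⟩ := hfin.exists_minimalFor id _ he
        refine ⟨y, hy.2.1, fun x hx hx0 => ?_⟩
        by_contra! hxy
        have htx : t < x := by
          by_contra! hxt
          exact hne x ⟨hx, hx0, hxt⟩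
        exact absurd (hmin ⟨hx, htx, hxy.le.trans hy.2.2⟩ hxy.le) (not_le.2 hxy)
      · refine ⟨t + 1, by simp, fun x hx hx0 => ?_⟩
        by_contra! hxt
        refine he ⟨x, hx, ?_, hxt.le⟩
        by_contra! hxt
        exact hne x ⟨hx, hx0, hxt⟩
    have h1 : (r : EReal) ≤ φ.nextPoint := by
      refine le_sInf ?_
      rintro _ ⟨x, hx, hx0, rfl⟩
      exact EReal.coe_le_coe_iff.2 (hrt x hx hx0)
    exact absurd (EReal.coe_le_coe_iff.1 (h1.trans h)) (not_le.2 hr)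
  · rintro ⟨x, hx, hx0, hxt⟩
    exact (sInf_le ⟨x, hx, hx0, rfl⟩ : φ.nextPoint ≤ x).trans (EReal.coe_le_coe_iff.2 hxt)

theorem requestedWithin_iff (φ : PointConfig) (t : ℝ) :
    φ.RequestedWithin t ↔ φ.count (Ico (-t) 0) ≠ 0 := by
  rw [count_ne_zero_iff φ measurableSet_Ico]
  simp only [RequestedWithin, Set.Nonempty, mem_inter_iff, mem_Ico, ← EReal.coe_neg,
    EReal.coe_le_coe_iff]

/-- Layer-cake form of `t(1)`, which turns the Palm mean into an integral of Palm tail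
probabilities. -/
theorem toENNReal_nextPoint (φ : PointConfig) :
    φ.nextPoint.toENNReal = ∫⁻ s in Ioi 0, {s | φ.count (Ioc 0 s) = 0}.indicator 1 s := by
  have hs : {s : ℝ | φ.count (Ioc 0 s) = 0} = {s : ℝ | (s : EReal) < φ.nextPoint} := by
    ext s
    simp [← not_iff_not, ← nextPoint_le_iff]
  have hm : MeasurableSet {s : ℝ | (s : EReal) < φ.nextPoint} :=
    measurableSet_Iio.preimage measurable_coe_real_ereal
  rw [hs, lintegral_indicator_one hm, Measure.restrict_apply hm]
  induction φ.nextPoint with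
  | bot => simp
  | top => simp
  | coe r =>
    have : {s : ℝ | (s : EReal) < (r : EReal)} ∩ Ioi 0 = Ioo 0 r := by
      ext s
      simp [and_comm]
    rw [this]
    simp

end PointConfig

/-! ### Palm integrals: mass transport and inversion -/

/-- The unnormalized Palm expectation of a stationary point process with law `Q`. -/
noncomputable def palmIntegral (Q : Measure PointConfig) (f : PointConfig → ℝ≥0∞) : ℝ≥0∞ :=
  ∫⁻ φ, ∫⁻ x in Ioc 0 1, f (φ.shift x) ∂φ.count ∂Q

theorem measurable_setLIntegral_count_shift {f : PointConfig → ℝ≥0∞} (hf : Measurable f) :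
    Measurable fun φ : PointConfig => ∫⁻ x in Ioc 0 1, f (φ.shift x) ∂φ.count :=
  measurable_setLIntegral_count (f := fun φ x => f (φ.shift x)) measurable_id
    (hf.comp (measurable_shift.comp measurable_swap)) measurableSet_Ioc

theorem palmIntegral_add (Q : Measure PointConfig) {f g : PointConfig → ℝ≥0∞} (hf : Measurable f) :
    palmIntegral Q (fun φ => f φ + g φ) = palmIntegral Q f + palmIntegral Q g := by
  rw [palmIntegral, palmIntegral, palmIntegral,
    ← lintegral_add_left (measurable_setLIntegral_count_shift hf)]
  refine lintegral_congr fun φ => ?_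
  exact lintegral_add_left
    (hf.comp (measurable_shift.comp (measurable_id.prodMk measurable_const))) _

theorem palmIntegral_lintegral (Q : Measure PointConfig) [SFinite Q] {α : Type*}
    [MeasurableSpace α] (μ : Measure α) [SFinite μ] {f : α → PointConfig → ℝ≥0∞}
    (hf : Measurable (Function.uncurry f)) :
    palmIntegral Q (fun φ => ∫⁻ a, f a φ ∂μ) = ∫⁻ a, palmIntegral Q (f a) ∂μ := by
  have h1 : Measurable fun p : (PointConfig × α) × ℝ => f p.1.2 (p.1.1.shift p.2) :=
    hf.comp ((measurable_snd.comp measurable_fst).prodMk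
      (measurable_shift.comp (measurable_snd.prodMk (measurable_fst.comp measurable_fst))))
  simp_rw [palmIntegral]
  rw [lintegral_lintegral_swap]
  · refine lintegral_congr fun φ => ?_
    rw [lintegral_lintegral_swap]
    exact (h1.comp ((measurable_const.prodMk measurable_snd).prodMk
      measurable_fst)).aemeasurable
  · exact (measurable_setLIntegral_count (M := fun p : α × PointConfig => p.2)
      (f := fun p x => f p.1 (p.2.shift x)) measurable_snd
      (h1.comp ((measurable_swap.comp measurable_fst).prodMk measurable_snd))
      measurableSet_Ioc).aemeasurable

/-- The mass transport principle. -/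
theorem palmIntegral_count_eq_reversed {Q : Measure PointConfig} [SFinite Q]
    (hQ : ∀ s, Q.map (shift s) = Q) {g : ℝ → PointConfig → ℝ≥0∞}
    (hg : Measurable (Function.uncurry g)) :
    palmIntegral Q (fun φ => ∫⁻ z, g z φ ∂φ.count) =
      palmIntegral Q (fun φ => ∫⁻ w, g (-w) (φ.shift w) ∂φ.count) := by
  let e : ℝ → ℝ≥0∞ := (Ioc (0 : ℝ) 1).indicator 1
  have he : Measurable e := measurable_one.indicator measurableSet_Ioc
  have he' (y : ℝ) : e y ≠ ⊤ := by
    by_cases hy : y ∈ Ioc (0 : ℝ) 1 <;> simp [e, hy]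
  have heI (f : ℝ → ℝ≥0∞) (μ : Measure ℝ) : ∫⁻ x in Ioc 0 1, f x ∂μ = ∫⁻ x, e x * f x ∂μ := by
    rw [← lintegral_indicator measurableSet_Ioc]
    refine lintegral_congr fun x => ?_
    by_cases hx : x ∈ Ioc (0 : ℝ) 1 <;> simp [e, hx]
  have hez (z : ℝ) : ∫⁻ s, e (z + s) = 1 := by
    rw [lintegral_add_left_eq_self, lintegral_indicator_one measurableSet_Ioc]
    simp
  have hm : Measurable fun p : (ℝ × PointConfig) × ℝ => e (p.2 + p.1.1) * g p.2 p.1.2 :=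
    (he.comp (measurable_snd.add (measurable_fst.comp measurable_fst))).mul
      (hg.comp (measurable_snd.prodMk (measurable_snd.comp measurable_fst)))
  symm
  -- Both sides sum `g (y - x)`, seen from `x`, over ordered pairs of points. Only the unit window
  -- differs: it sits on `y` here and on `x` at the end, Campbell's formula making the exchange
  -- because `e` has integral one.
  calc palmIntegral Q (fun φ => ∫⁻ w, g (-w) (φ.shift w) ∂φ.count)
      = ∫⁻ φ, ∫⁻ x, (∫⁻ y, e y * g (y - x) (φ.shift x) ∂φ.count) ∂φ.count ∂Q := by
        refine lintegral_congr fun φ => ?_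
        rw [heI, lintegral_lintegral_swap]
        · refine lintegral_congr fun y => ?_
          beta_reduce
          rw [lintegral_count_shift, lintegral_const_mul' _ _ (he' y)]
          simp_rw [shift_shift, add_sub_cancel, neg_sub]
        · exact ((he.comp measurable_snd).mul (hg.comp ((measurable_snd.sub
            measurable_fst).prodMk (measurable_shift.comp
              (measurable_fst.prodMk measurable_const))))).aemeasurable
    _ = ∫⁻ φ, ∫⁻ x, (∫⁻ z, e (z + x) * g z (φ.shift x) ∂(φ.shift x).count) ∂φ.count ∂Q := by
        refine lintegral_congr fun φ => lintegral_congr fun x => ?_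
        rw [lintegral_count_shift]
        simp
    _ = ∫⁻ s, palmIntegral Q (fun φ => ∫⁻ z, e (z + s) * g z φ ∂φ.count) :=
        lintegral_count_shift_eq_palm hQ
          (h := fun s φ => ∫⁻ z, e (z + s) * g z φ ∂φ.count)
          (measurable_lintegral_count (M := fun p : ℝ × PointConfig => p.2)
            (f := fun p z => e (z + p.1) * g z p.2) measurable_snd hm)
    _ = palmIntegral Q (fun φ => ∫⁻ s : ℝ, ∫⁻ z, e (z + s) * g z φ ∂φ.count) :=
        (palmIntegral_lintegral Q _ (measurable_lintegral_count (M := fun p : ℝ × PointConfig => p.2)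
            (f := fun p z => e (z + p.1) * g z p.2) measurable_snd hm)).symm
    _ = palmIntegral Q (fun φ => ∫⁻ z, g z φ ∂φ.count) := by
        congr 1
        funext φ
        rw [lintegral_lintegral_swap]
        · refine lintegral_congr fun z => ?_
          exact (lintegral_mul_const _ (he.comp (measurable_const_add z))).trans (by simp [hez])
        · exact (hm.comp ((measurable_fst.prodMk measurable_const).prodMk
            measurable_snd)).aemeasurable

/-- Forward and backward recurrence times have the same Palm distribution. -/
theorem palmIntegral_backward_eq_forward {Q : Measure PointConfig} [SFinite Q]
    (hQ : ∀ s, Q.map (shift s) = Q) (t : ℝ) :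
    palmIntegral Q ({φ | φ.count (Ico (-t) 0) ≠ 0}.indicator 1) =
      palmIntegral Q ({φ | φ.count (Ioc 0 t) ≠ 0}.indicator 1) := by
  -- Each point sends unit mass to the first point within distance `t` to its right. The mass it
  -- receives comes from the last point within distance `t` to its left.
  let D : Set (ℝ × PointConfig) := {p | p.1 ∈ Ioc 0 t} ∩ {p | p.2.count (Ioc 0 t ∩ Iio p.1) = 0}
  have hD : MeasurableSet D := by
    refine (measurableSet_Ioc.preimage measurable_fst).inter
      (measurableSet_count_eq_zero measurable_snd ?_)
    exact (measurableSet_Ioc.preimage measurable_snd).inter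
      (measurableSet_lt measurable_snd (measurable_fst.comp measurable_fst))
  have h := palmIntegral_count_eq_reversed hQ (g := fun z φ => D.indicator 1 (z, φ))
    (measurable_one.indicator hD)
  symm
  convert h using 2
  · funext φ
    rw [← setLIntegral_count_first φ measurableSet_Ioc 0 (fun x hx => hx.1.le),
      ← lintegral_indicator measurableSet_Ioc]
    refine lintegral_congr fun z => ?_
    by_cases hz : z ∈ Ioc 0 t <;> simp only [D, hz, indicator, mem_inter_iff, mem_ofPred_eq,
      true_and, false_and, if_true, if_false, Pi.one_apply]
  · funext φ
    rw [← setLIntegral_count_last φ measurableSet_Ico 0 (fun x hx => hx.2.le),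
      ← lintegral_indicator measurableSet_Ico]
    refine lintegral_congr fun w => ?_
    have h1 : -w ∈ Ioc 0 t ↔ w ∈ Ico (-t) 0 := by
      simp only [mem_Ioc, mem_Ico]
      constructor <;> rintro ⟨h, h'⟩ <;> constructor <;> linarith
    by_cases hw : w ∈ Ico (-t) 0
    · have h2 : (fun x => x - w) ⁻¹' (Ioc 0 t ∩ Iio (-w)) = Ico (-t) 0 ∩ Ioi w := by
        ext x
        simp only [mem_preimage, mem_inter_iff, mem_Ioc, mem_Iio, mem_Ico, mem_Ioi]
        have := hw.1
        constructor
        · rintro ⟨⟨h, h'⟩, h''⟩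
          exact ⟨⟨by linarith, by linarith⟩, by linarith⟩
        · rintro ⟨⟨h, h'⟩, h''⟩
          exact ⟨⟨by linarith, by linarith⟩, by linarith⟩
      simp only [D, indicator, mem_inter_iff, mem_ofPred_eq, h1, hw, true_and, if_true,
        count_shift_apply _ _ (measurableSet_Ioc.inter measurableSet_Iio), h2, Pi.one_apply]
    · simp only [D, indicator, mem_inter_iff, mem_ofPred_eq, h1, hw, false_and, if_false]

theorem measurableSet_count_Ioc_eq_zero :
    MeasurableSet {p : ℝ × PointConfig | p.2.count (Ioc 0 p.1) = 0} :=
  measurableSet_count_eq_zero measurable_snd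
    ((measurableSet_lt measurable_const measurable_snd).inter
      (measurableSet_le measurable_snd (measurable_fst.comp measurable_fst)))

/-- Inversion formula: the last point before the origin. -/
theorem measure_count_ne_zero_eq {Q : Measure PointConfig} [SFinite Q]
    (hQ : ∀ s, Q.map (shift s) = Q) {B : Set ℝ} (hB : MeasurableSet B)
    (hB0 : ∀ x ∈ B, x ≤ 0 ∧ B ∩ Ioi x = Ioc x 0) :
    Q {φ | φ.count B ≠ 0} =
      ∫⁻ s in -B, palmIntegral Q ({φ | φ.count (Ioc 0 s) = 0}.indicator 1) := by
  -- Count only the last point `x` of `B`. By `hB0`, being last means, seen from `x`, that `(0, -x]`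
  -- is empty.
  have h := lintegral_count_shift_eq_palm hQ
    (h := fun x φ => B.indicator 1 x * {p : ℝ × PointConfig | p.2.count (Ioc 0 p.1) = 0}.indicator 1 (-x, φ))
    (((measurable_one.indicator hB).comp measurable_fst).mul
      ((measurable_one.indicator measurableSet_count_Ioc_eq_zero).comp
        (measurable_fst.neg.prodMk measurable_snd)))
  have hm : MeasurableSet {φ : PointConfig | φ.count B ≠ 0} :=
    (measurable_count_apply hB (measurableSet_singleton 0)).compl
  rw [← lintegral_indicator_one hm]
  convert h using 1
  · refine lintegral_congr fun φ => ?_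
    rw [← setLIntegral_count_last φ hB 0 fun x hx => (hB0 x hx).1, ← lintegral_indicator hB]
    refine lintegral_congr fun x => ?_
    by_cases hx : x ∈ B
    · have h2 : (fun y => y - x) ⁻¹' (Ioc 0 (-x)) = Ioc x 0 := by
        ext y
        simp
      simp only [hx, indicator_of_mem, one_mul, Pi.one_apply]
      simp only [indicator, mem_ofPred_eq, count_shift_apply _ _ measurableSet_Ioc, h2,
        (hB0 x hx).2, Pi.one_apply]
    · simp [hx]
  · rw [← lintegral_indicator hB.neg, ← lintegral_neg_eq_self]
    refine lintegral_congr fun s => ?_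
    by_cases hs : s ∈ B
    · simp [hs, palmIntegral, indicator]
    · simp [hs]

theorem palmIntegral_mono (Q : Measure PointConfig) {f g : PointConfig → ℝ≥0∞} (h : f ≤ g) :
    palmIntegral Q f ≤ palmIntegral Q g :=
  lintegral_mono fun _ => lintegral_mono fun _ => h _

theorem measurableSet_count_eq_zero_const {B : Set ℝ} (hB : MeasurableSet B) :
    MeasurableSet {φ : PointConfig | φ.count B = 0} :=
  measurable_count_apply hB (measurableSet_singleton 0)

theorem measurableSet_count_ne_zero_const {B : Set ℝ} (hB : MeasurableSet B) :
    MeasurableSet {φ : PointConfig | φ.count B ≠ 0} :=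
  (measurableSet_count_eq_zero_const hB).compl

theorem palmIntegral_compl_add (Q : Measure PointConfig) {B : Set ℝ} (hB : MeasurableSet B) :
    palmIntegral Q ({φ | φ.count B = 0}.indicator 1) +
      palmIntegral Q ({φ | φ.count B ≠ 0}.indicator 1) = palmIntegral Q 1 := by
  rw [← palmIntegral_add Q (measurable_one.indicator (measurableSet_count_eq_zero_const hB))]
  congr 1
  funext φ
  by_cases h : φ.count B = 0 <;> simp [indicator, h]

theorem antitone_palmIntegral_count_Ioc (Q : Measure PointConfig) :
    Antitone fun s : ℝ => palmIntegral Q ({φ | φ.count (Ioc 0 s) = 0}.indicator 1) := by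
  intro s t hst
  refine palmIntegral_mono Q (indicator_le_indicator_of_subset (fun φ hφ => ?_) fun _ => zero_le)
  exact measure_mono_null (Ioc_subset_Ioc_right hst) hφ

/-- A stationary point process has no fixed atom. -/
theorem measure_count_singleton {Q : Measure PointConfig} [SFinite Q]
    (hQ : ∀ s, Q.map (shift s) = Q) (c : ℝ) : Q {φ | φ.count {c} ≠ 0} = 0 := by
  have hc : Measurable fun φ : PointConfig => φ.count {c} :=
    measurable_count_apply (measurableSet_singleton c)
  have h := lintegral_count_shift_eq_palm hQ (h := fun x _ => ({c} : Set ℝ).indicator 1 x)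
    ((measurable_one.indicator (measurableSet_singleton c)).comp measurable_fst)
  simp_rw [lintegral_indicator_one (measurableSet_singleton c)] at h
  have h0 : ∫⁻ s, ∫⁻ φ : PointConfig, ∫⁻ x in Ioc (0 : ℝ) 1, ({c} : Set ℝ).indicator 1 s ∂φ.count ∂Q =
      ∫⁻ _ : ℝ, 0 := by
    refine lintegral_congr_ae ?_
    have : ∀ᵐ s : ℝ, s ≠ c := by simp [ae_iff]
    filter_upwards [this] with s hs
    simp [hs]
  rw [h0, lintegral_zero, lintegral_eq_zero_iff hc] at h
  exact h

/-! ### Request processes and the Palm quantities of the model -/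

section SingleProcess

variable {Ω : Type*} [MeasurableSpace Ω] {P : Measure Ω} {M : Ω → PointConfig}

theorem IsRequestProcess.map_shift (hM : IsRequestProcess P M) (s : ℝ) :
    (P.map M).map (shift s) = P.map M := by
  rw [Measure.map_map (measurable_shift_const s) hM.measurable]
  exact hM.stationary s

theorem intensity_eq_palmIntegral (hM : Measurable M) :
    intensity P M = palmIntegral (P.map M) 1 := by
  rw [palmIntegral, lintegral_map (measurable_setLIntegral_count_shift measurable_one) hM]
  refine lintegral_congr fun ω => ?_
  simp [count_apply]

/-- By stationarity the probability of a point in `(-∞, k]` does not depend on `k`, so it equals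
that of having any point at all. The latter is 0 or 1 by ergodicity, and positive intensity excludes
0. -/
theorem IsRequestProcess.measure_count_Iic [IsProbabilityMeasure P] (hM : IsRequestProcess P M) :
    P.map M {φ | φ.count (Iic 0) ≠ 0} = 1 := by
  have hmeas (k : ℝ) : MeasurableSet {φ : PointConfig | φ.count (Iic k) ≠ 0} :=
    (measurableSet_count_ne_zero_const measurableSet_Iic)
  have hk (k : ℝ) : P.map M {φ | φ.count (Iic k) ≠ 0} = P.map M {φ | φ.count (Iic 0) ≠ 0} := by
    conv_rhs => rw [← hM.map_shift k, Measure.map_apply (measurable_shift_const k) (hmeas 0)]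
    congr 1
    ext φ
    have : (fun x => x - k) ⁻¹' Iic 0 = Iic k := by ext; simp
    simp [count_shift_apply _ _ measurableSet_Iic, this]
  have hU : {φ : PointConfig | φ.count univ ≠ 0} = ⋃ k : ℕ, {φ | φ.count (Iic (k : ℝ)) ≠ 0} := by
    ext φ
    simp only [mem_iUnion, mem_ofPred_eq]
    rw [count_ne_zero_iff _ MeasurableSet.univ]
    simp_rw [count_ne_zero_iff _ measurableSet_Iic]
    constructor
    · rintro ⟨x, hx, -⟩
      obtain ⟨k, hk⟩ := exists_nat_ge x
      exact ⟨k, x, hx, hk⟩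
    · rintro ⟨k, x, hx, -⟩
      exact ⟨x, hx, trivial⟩
  have hlim : P.map M {φ | φ.count univ ≠ 0} = P.map M {φ | φ.count (Iic 0) ≠ 0} := by
    rw [hU, Monotone.measure_iUnion]
    · simp [hk]
    · intro i j hij φ (hφ : φ.count _ ≠ 0)
      exact fun h => hφ (measure_mono_null (Iic_subset_Iic.2 (by exact_mod_cast hij)) h)
  have hm0 : MeasurableSet {φ : PointConfig | φ.count univ ≠ 0} :=
    measurableSet_count_ne_zero_const MeasurableSet.univ
  rw [← hlim, Measure.map_apply hM.measurable hm0]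
  have hinv (s : ℝ) : shift s ⁻¹' {φ : PointConfig | φ.count univ ≠ 0} =
      {φ : PointConfig | φ.count univ ≠ 0} := by
    ext φ
    change (φ.shift s).count univ ≠ 0 ↔ φ.count univ ≠ 0
    rw [count_shift_apply _ _ MeasurableSet.univ, preimage_univ]
  refine (hM.ergodic _ hm0 hinv).resolve_left fun h => ?_
  have hz : intensity P M = 0 := by
    rw [intensity, ← lintegral_zero (μ := P)]
    refine lintegral_congr_ae ?_
    have hae : ∀ᵐ ω ∂P, (M ω).count univ = 0 := by
      rw [ae_iff]
      exact h
    filter_upwards [hae] with ω hω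
    rw [← count_apply _ measurableSet_Ioc]
    exact measure_mono_null (subset_univ _) hω
  exact hM.intensity_pos.ne' hz

/-- Almost surely neither endpoint is a point. The inversion formula needs the interval closed at
the origin, whereas requests are counted in `[-t, 0)`. -/
theorem IsRequestProcess.measure_requestedWithin_eq_Ioc [IsProbabilityMeasure P]
    (hM : IsRequestProcess P M) (t : ℝ) :
    P {ω | (M ω).RequestedWithin t} = P.map M {φ | φ.count (Ioc (-t) 0) ≠ 0} := by
  have h1 : P {ω | (M ω).RequestedWithin t} = P.map M {φ | φ.count (Ico (-t) 0) ≠ 0} := by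
    rw [Measure.map_apply hM.measurable (measurableSet_count_ne_zero_const measurableSet_Ico)]
    simp_rw [requestedWithin_iff]
    rfl
  rw [h1]
  refine measure_congr ?_
  have h0 (c : ℝ) : ∀ᵐ φ ∂(P.map M), φ.count {c} = 0 := by
    rw [ae_iff]
    exact measure_count_singleton hM.map_shift c
  filter_upwards [h0 0, h0 (-t)] with φ hφ hφt
  refine propext (not_iff_not.2 ?_)
  constructor
  · intro h
    refine measure_mono_null (t := Ico (-t) 0 ∪ {0}) ?_ (measure_union_null h hφ)
    intro x hx
    by_cases hx0 : x = 0
    · exact Or.inr hx0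
    · exact Or.inl ⟨hx.1.le, lt_of_le_of_ne hx.2 hx0⟩
  · intro h
    refine measure_mono_null (t := Ioc (-t) 0 ∪ {-t}) ?_ (measure_union_null h hφt)
    intro x hx
    by_cases hx0 : x = -t
    · exact Or.inr hx0
    · exact Or.inl ⟨lt_of_le_of_ne hx.1 (Ne.symm hx0), hx.2.le⟩

end SingleProcess

section System

variable {Ω : Type*} [MeasurableSpace Ω] {P : Measure Ω} {N : ℕ → Ω → PointConfig} {i : ℕ}

theorem palmExp_apply_self (hM : Measurable (N i)) {g : PointConfig → ℝ≥0∞} (hg : Measurable g) :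
    palmExp P N i (fun ψ => g (ψ i)) = palmIntegral (P.map (N i)) g / intensity P (N i) := by
  rw [palmExp, palmIntegral, lintegral_map (measurable_setLIntegral_count_shift hg) hM]
  congr 1
  refine lintegral_congr fun ω => ?_
  exact tsum_points (N i ω) _ measurableSet_Ioc fun s => g ((N i ω).shift s)

theorem interCDF_eq (hM : Measurable (N i)) (t : ℝ) :
    interCDF P N i t =
      (palmIntegral (P.map (N i)) ({φ | φ.count (Ioc 0 t) ≠ 0}.indicator 1)).toReal /
        rate P N i := by
  rw [interCDF, palmProb, rate, ← ENNReal.toReal_div, ← palmExp_apply_self hM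
    (measurable_one.indicator (measurableSet_count_ne_zero_const measurableSet_Ioc))]
  congr 2
  funext ψ
  simp [indicator, nextPoint_le_iff]

theorem hitTTL_eq_interCDF [IsProbabilityMeasure P] (hM : IsRequestProcess P (N i)) (t : ℝ) :
    hitTTL P N t i = interCDF P N i t := by
  rw [interCDF_eq hM.measurable, ← palmIntegral_backward_eq_forward hM.map_shift, hitTTL, palmProb,
    rate, ← ENNReal.toReal_div, ← palmExp_apply_self hM.measurable
    (measurable_one.indicator (measurableSet_count_ne_zero_const measurableSet_Ico))]
  congr 2
  funext ψ
  simp [indicator, requestedWithin_iff]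

theorem rate_pos (hM : IsRequestProcess P (N i)) : 0 < rate P N i :=
  ENNReal.toReal_pos hM.intensity_pos.ne' hM.intensity_lt_top.ne

theorem palmIntegral_indicator_lt_top (hM : IsRequestProcess P (N i)) (A : Set PointConfig) :
    palmIntegral (P.map (N i)) (A.indicator 1) < ⊤ := by
  refine lt_of_le_of_lt (palmIntegral_mono _ (g := 1) ?_)
    ((intensity_eq_palmIntegral hM.measurable).symm.trans_lt hM.intensity_lt_top)
  exact indicator_le_self' fun _ _ => zero_le

theorem one_sub_interCDF (hM : IsRequestProcess P (N i)) (t : ℝ) :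
    1 - interCDF P N i t =
      (rate P N i)⁻¹ * (palmIntegral (P.map (N i)) ({φ | φ.count (Ioc 0 t) = 0}.indicator 1)).toReal := by
  have h := palmIntegral_compl_add (P.map (N i)) (measurableSet_Ioc (a := (0 : ℝ)) (b := t))
  rw [← intensity_eq_palmIntegral hM.measurable] at h
  have h' := congrArg ENNReal.toReal h
  rw [ENNReal.toReal_add (palmIntegral_indicator_lt_top hM _).ne
    (palmIntegral_indicator_lt_top hM _).ne] at h'
  have := (rate_pos hM).ne'
  rw [interCDF_eq hM.measurable]
  change _ = rate P N i at h'
  field_simp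
  linarith

theorem interCDF_le_one (hM : IsRequestProcess P (N i)) (t : ℝ) : interCDF P N i t ≤ 1 := by
  rw [← sub_nonneg, one_sub_interCDF hM]
  exact mul_nonneg (inv_nonneg.2 (rate_pos hM).le) ENNReal.toReal_nonneg

theorem monotone_interCDF (hM : IsRequestProcess P (N i)) : Monotone (interCDF P N i) := by
  intro s t hst
  rw [← sub_le_sub_iff_left 1, one_sub_interCDF hM, one_sub_interCDF hM]
  gcongr
  · exact inv_nonneg.2 (rate_pos hM).le
  · exact (palmIntegral_indicator_lt_top hM _).ne
  · exact antitone_palmIntegral_count_Ioc _ hst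

/-- Inversion with `B = (-∞, 0]`: almost surely there is a point in the past, so the Palm tails
integrate to one before division by the intensity. -/
theorem interMean_eq [IsProbabilityMeasure P] (hM : IsRequestProcess P (N i)) :
    interMean P N i = (rate P N i)⁻¹ := by
  have hm : Measurable (Function.uncurry fun (s : ℝ) (φ : PointConfig) =>
      {p : ℝ × PointConfig | p.2.count (Ioc 0 p.1) = 0}.indicator (1 : ℝ × PointConfig → ℝ≥0∞) (s, φ)) :=
    measurable_one.indicator measurableSet_count_Ioc_eq_zero
  have h1 : palmExp P N i (fun ψ => (ψ i).nextPoint.toENNReal) =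
      palmIntegral (P.map (N i)) (fun φ => ∫⁻ s in Ioi 0,
        {p : ℝ × PointConfig | p.2.count (Ioc 0 p.1) = 0}.indicator 1 (s, φ)) /
        intensity P (N i) := by
    rw [← palmExp_apply_self hM.measurable]
    · simp_rw [toENNReal_nextPoint]
      rfl
    · exact hm.lintegral_prod_left'
  have hB : P.map (N i) {φ | φ.count (Iic 0) ≠ 0} =
      ∫⁻ s in -Iic 0, palmIntegral (P.map (N i)) ({φ | φ.count (Ioc 0 s) = 0}.indicator 1) := by
    refine measure_count_ne_zero_eq hM.map_shift measurableSet_Iic fun x hx => ⟨hx, ?_⟩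
    ext y
    simp [and_comm]
  rw [hM.measure_count_Iic, neg_Iic, neg_zero, ← setLIntegral_congr Ioi_ae_eq_Ici] at hB
  rw [interMean, h1, palmIntegral_lintegral _ _ hm]
  change (_ / intensity P (N i)).toReal = _
  rw [show ∫⁻ s in Ioi 0, palmIntegral (P.map (N i)) (fun φ =>
      {p : ℝ × PointConfig | p.2.count (Ioc 0 p.1) = 0}.indicator 1 (s, φ)) = 1 from hB.symm]
  simp [rate]

theorem hatCDF_eq [IsProbabilityMeasure P] (hM : IsRequestProcess P (N i)) (t : ℝ) :
    hatCDF P N i t = rate P N i * ∫ z in (0 : ℝ)..t, (1 - interCDF P N i z) := by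
  rw [hatCDF, interMean_eq hM, inv_inv]

/-- The stationary probability of a request in `[-t, 0)` is `Ĝ(t)`. -/
theorem measureReal_requestedWithin [IsProbabilityMeasure P] (hM : IsRequestProcess P (N i))
    {t : ℝ} (ht : 0 ≤ t) :
    P.real {ω | (N i ω).RequestedWithin t} = hatCDF P N i t := by
  have hB : P.map (N i) {φ | φ.count (Ioc (-t) 0) ≠ 0} =
      ∫⁻ s in -Ioc (-t) 0, palmIntegral (P.map (N i)) ({φ | φ.count (Ioc 0 s) = 0}.indicator 1) := by
    refine measure_count_ne_zero_eq hM.map_shift measurableSet_Ioc fun x hx => ⟨hx.2, ?_⟩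
    ext y
    simp only [mem_inter_iff, mem_Ioc, mem_Ioi]
    exact ⟨fun h => ⟨h.2, h.1.2⟩, fun h => ⟨⟨hx.1.trans h.1, h.2⟩, h.1⟩⟩
  rw [measureReal_def, hM.measure_requestedWithin_eq_Ioc, hB, neg_Ioc, neg_zero, neg_neg,
    setLIntegral_congr Ico_ae_eq_Ioc, hatCDF_eq hM, ← intervalIntegral.integral_const_mul,
    intervalIntegral.integral_of_le ht, ← integral_toReal]
  · refine integral_congr_ae (Eventually.of_forall fun s => ?_)
    simp only [one_sub_interCDF hM]
    rw [mul_inv_cancel_left₀ (rate_pos hM).ne']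
  · exact (antitone_palmIntegral_count_Ioc _).measurable.aemeasurable
  · exact Eventually.of_forall fun s => palmIntegral_indicator_lt_top hM _

end System

/-! ### Concentration of the number of distinct contents -/

/-- Chebyshev's inequality for the number of independent events that occur. -/
theorem measure_abs_sum_indicator_sub_le {Ω ι : Type*} [MeasurableSpace Ω] [Fintype ι]
    {P : Measure Ω} [IsProbabilityMeasure P] {X : ι → Ω → ℝ} (hX : ∀ j, Measurable (X j))
    (h01 : ∀ j ω, X j ω = 0 ∨ X j ω = 1) (hind : iIndepFun X P) {a : ℝ} (ha : 0 < a) :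
    P {ω | a ≤ |∑ j, X j ω - ∑ j, ∫ ω, X j ω ∂P|} ≤ ENNReal.ofReal ((∑ j, ∫ ω, X j ω ∂P) / a ^ 2) := by
  have hL (j : ι) : MemLp (X j) 2 P := by
    refine MemLp.of_bound (hX j).aestronglyMeasurable 1 (Eventually.of_forall fun ω => ?_)
    rcases h01 j ω with h | h <;> simp [h]
  have hLs : MemLp (∑ j, X j) 2 P := memLp_finsetSum' _ fun j _ => hL j
  have hE : P[∑ j, X j] = ∑ j, ∫ ω, X j ω ∂P := by
    simp only [Finset.sum_apply]
    exact integral_finsetSum _ fun j _ => (hL j).integrable one_le_two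
  have hV : Var[∑ j, X j; P] ≤ ∑ j, ∫ ω, X j ω ∂P := by
    rw [IndepFun.variance_sum (fun j _ => hL j) fun j _ k _ hjk => hind.indepFun hjk]
    refine Finset.sum_le_sum fun j _ => ?_
    -- An indicator equals its square, so the second moment is the mean.
    refine (variance_le_expectation_sq (hX j).aestronglyMeasurable).trans (le_of_eq ?_)
    refine integral_congr_ae (Eventually.of_forall fun ω => ?_)
    rcases h01 j ω with h | h <;> simp [h]
  have h := meas_ge_le_variance_div_sq hLs ha
  rw [hE] at h
  simp only [Finset.sum_apply] at h
  exact h.trans (ENNReal.ofReal_le_ofReal (by gcongr))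

/-- Points of a process see an independent process as from a deterministic position. -/
theorem lintegral_count_indep_le {Ω β : Type*} [MeasurableSpace Ω] [MeasurableSpace β]
    {P : Measure Ω} [IsProbabilityMeasure P] {M : Ω → PointConfig} {Y : Ω → β} (hM : Measurable M)
    (hY : Measurable Y) (hMY : IndepFun M Y P) {D : Set (ℝ × β)} (hD : MeasurableSet D) {c : ℝ≥0∞}
    (hc : ∀ x, P {ω | (x, Y ω) ∈ D} ≤ c) :
    ∫⁻ ω, ∫⁻ x in Ioc 0 1, D.indicator 1 (x, Y ω) ∂(M ω).count ∂P ≤ c * intensity P M := by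
  have hg : Measurable fun p : PointConfig × β =>
      ∫⁻ x in Ioc (0 : ℝ) 1, D.indicator (1 : ℝ × β → ℝ≥0∞) (x, p.2) ∂p.1.count :=
    measurable_setLIntegral_count (f := fun (p : PointConfig × β) x => D.indicator 1 (x, p.2))
      measurable_fst ((measurable_one.indicator hD).comp
        (measurable_snd.prodMk (measurable_snd.comp measurable_fst))) measurableSet_Ioc
  calc ∫⁻ ω, ∫⁻ x in Ioc 0 1, D.indicator 1 (x, Y ω) ∂(M ω).count ∂P
      = ∫⁻ φ, ∫⁻ y, (∫⁻ x in Ioc 0 1, D.indicator 1 (x, y) ∂φ.count) ∂(P.map Y) ∂(P.map M) := by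
        have := Measure.isProbabilityMeasure_map (μ := P) hY.aemeasurable
        rw [← lintegral_prod _ hg.aemeasurable,
          ← (indepFun_iff_map_prod_eq_prod_map_map hM.aemeasurable hY.aemeasurable).1 hMY,
          lintegral_map hg (hM.prodMk hY)]
    _ ≤ ∫⁻ φ, c * φ.count (Ioc 0 1) ∂(P.map M) := by
        have := Measure.isProbabilityMeasure_map (μ := P) hY.aemeasurable
        refine lintegral_mono fun φ => ?_
        rw [lintegral_lintegral_swap (f := fun y x => D.indicator 1 (x, y))
          ((measurable_one.indicator hD).comp measurable_swap).aemeasurable]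
        refine (lintegral_mono (g := fun _ => c) fun x => ?_).trans (by simp)
        rw [lintegral_map (f := fun y => D.indicator 1 (x, y))
          ((measurable_one.indicator hD).comp (measurable_const.prodMk measurable_id)) hY]
        refine le_trans (le_of_eq ?_) (hc x)
        exact lintegral_indicator_one (hD.preimage (measurable_const.prodMk hY))
    _ = c * intensity P M := by
        rw [lintegral_const_mul _ (measurable_count_apply measurableSet_Ioc),
          lintegral_map (measurable_count_apply measurableSet_Ioc) hM]
        simp_rw [count_apply _ measurableSet_Ioc]
        rfl

theorem requestedWithin_mono (φ : PointConfig) {s t : EReal} (hst : s ≤ t)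
    (h : φ.RequestedWithin s) : φ.RequestedWithin t := by
  obtain ⟨x, hx, hsx, hx0⟩ := h
  exact ⟨x, hx, (EReal.neg_le_neg_iff.2 hst).trans hsx, hx0⟩

theorem distinctCount_mono (n : ℕ) (ψ : ℕ → PointConfig) {s t : EReal} (hst : s ≤ t) :
    distinctCount n ψ s ≤ distinctCount n ψ t := by
  refine ncard_le_ncard (fun j hj => ⟨hj.1, requestedWithin_mono _ hst hj.2⟩) ?_
  exact (finite_Icc 1 n).subset fun j hj => hj.1

open Classical in
theorem distinctCount_eq_sum (n : ℕ) (ψ : ℕ → PointConfig) (t : EReal) :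
    (distinctCount n ψ t : ℝ) =
      ∑ j : Finset.Icc 1 n, if (ψ j).RequestedWithin t then (1 : ℝ) else 0 := by
  rw [Finset.sum_coe_sort (Finset.Icc 1 n)
    (fun j => if (ψ j).RequestedWithin t then (1 : ℝ) else 0), Finset.sum_boole, distinctCount,
    ← ncard_coe_finset]
  congr 2
  ext j
  simp

section System

variable {Ω : Type*} [MeasurableSpace Ω] {P : Measure Ω} {N : ℕ → Ω → PointConfig} {i n : ℕ}

/-- The upper integral is additive as soon as one summand is measurable, so the majorant `H` spares
any measurability of `A`, `B` and `E`. -/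
theorem palmExp_indicator_le_add {A B E : Set (ℕ → PointConfig)} {H : Ω → ℝ≥0∞}
    (hH : Measurable H)
    (hE : ∀ ω, ∑' s : ↥((N i ω).points ∩ Ioc 0 1), E.indicator 1 (fun j => (N j ω).shift s) ≤ H ω)
    (hAB : A ⊆ B ∪ E) :
    palmExp P N i (A.indicator 1) ≤
      palmExp P N i (B.indicator 1) + (∫⁻ ω, H ω ∂P) / intensity P (N i) := by
  rw [palmExp, palmExp, ← ENNReal.add_div, ← lintegral_add_right _ hH]
  gcongr with ω
  refine le_trans ?_ (add_le_add_right (hE ω) _)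
  rw [← ENNReal.tsum_add]
  refine ENNReal.tsum_le_tsum fun s => ?_
  by_cases hA : (fun j => (N j ω).shift s) ∈ A
  · rcases hAB hA with h | h <;> simp [hA, h]
  · simp [hA]

theorem palmExp_indicator_lt_top (hM : IsRequestProcess P (N i)) (A : Set (ℕ → PointConfig)) :
    palmExp P N i (A.indicator 1) < ⊤ := by
  refine ENNReal.div_lt_top (ne_top_of_le_ne_top hM.intensity_lt_top.ne ?_) hM.intensity_pos.ne'
  refine lintegral_mono fun ω => ?_
  refine (ENNReal.tsum_le_tsum (g := fun _ => 1) fun s => ?_).trans (by simp)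
  exact indicator_le_self' (fun _ _ => zero_le) _

/-- Concentration of the number of distinct requested contents, seen from a request. -/
theorem exists_majorant_abs_distinctCount_sub [IsProbabilityMeasure P]
    (hN : ∀ j, 1 ≤ j → j ≤ n → IsRequestProcess P (N j))
    (hindep : iIndepFun (fun j : Finset.Icc 1 n => N j) P) (hi : i ∈ Finset.Icc 1 n)
    {t a : ℝ} (ht : 0 ≤ t) (ha : 0 < a) :
    ∃ H : Ω → ℝ≥0∞, Measurable H ∧
      (∀ ω, ∑' s : ↥((N i ω).points ∩ Ioc 0 1),
        {ψ | a + 1 ≤ |(distinctCount n ψ t : ℝ) - ∑ j ∈ Finset.Icc 1 n, hatCDF P N j t|}.indicator 1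
          (fun j => (N j ω).shift s) ≤ H ω) ∧
      ∫⁻ ω, H ω ∂P ≤ ENNReal.ofReal ((∑ j ∈ Finset.Icc 1 n, hatCDF P N j t) / a ^ 2) *
        intensity P (N i) := by
  have hN' (j : Finset.Icc 1 n) : IsRequestProcess P (N j) :=
    hN j (Finset.mem_Icc.1 j.2).1 (Finset.mem_Icc.1 j.2).2
  let i' : Finset.Icc 1 n := ⟨i, hi⟩
  let J : Finset (Finset.Icc 1 n) := Finset.univ.erase i'
  let Y : Ω → (J → PointConfig) := fun ω j => N j ω
  have hY : Measurable Y := measurable_pi_iff.2 fun j => (hN' j).measurable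
  let B : Set PointConfig := {φ | φ.RequestedWithin t}
  have hB : MeasurableSet B := by
    simp only [B, requestedWithin_iff]
    exact measurableSet_count_ne_zero_const measurableSet_Ico
  let f : PointConfig → ℝ := B.indicator 1
  have hf : Measurable f := measurable_one.indicator hB
  have hf01 (φ) : f φ = 0 ∨ f φ = 1 := by
    by_cases h : φ ∈ B <;> simp [f, h]
  have hind : IndepFun (N i) Y P := by
    have h := iIndepFun.indepFun_finset {i'} J (by simp [J]) hindep fun j => (hN' j).measurable
    exact h.comp (φ := fun y : ({i'} : Finset (Finset.Icc 1 n)) → PointConfig => y ⟨i', Finset.mem_singleton_self _⟩) (ψ := id)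
      (measurable_pi_apply _) measurable_id
  have hp0 (j : Finset.Icc 1 n) : 0 ≤ hatCDF P N j t := by
    rw [← measureReal_requestedWithin (hN' j) ht]
    exact measureReal_nonneg
  have hp1 (j : Finset.Icc 1 n) : hatCDF P N j t ≤ 1 := by
    rw [← measureReal_requestedWithin (hN' j) ht]
    exact measureReal_le_one
  -- By stationarity the mean is the same from every viewpoint `x`, so the Chebyshev bound is
  -- uniform in `x`, as `lintegral_count_indep_le` requires.
  have hint (j : Finset.Icc 1 n) (x : ℝ) : ∫ ω, f ((N j ω).shift x) ∂P = hatCDF P N j t := by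
    rw [← measureReal_requestedWithin (hN' j) ht,
      ← integral_map (φ := fun ω => (N j ω).shift x) (f := f)
        ((measurable_shift_const x).comp (hN' j).measurable).aemeasurable
        hf.aestronglyMeasurable, (hN' j).stationary x,
      integral_map (hN' j).measurable.aemeasurable hf.aestronglyMeasurable]
    exact integral_indicator_one (hB.preimage (hN' j).measurable)
  let m : ℝ := ∑ j : J, hatCDF P N j t
  have hsplit (g : Finset.Icc 1 n → ℝ) : ∑ j, g j = g i' + ∑ j : J, g j := by
    rw [Finset.sum_coe_sort J g, Finset.add_sum_erase _ g (Finset.mem_univ i')]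
  have hK : ∑ j ∈ Finset.Icc 1 n, hatCDF P N j t = hatCDF P N i t + m := by
    rw [← Finset.sum_coe_sort (Finset.Icc 1 n) (fun j => hatCDF P N j t), hsplit]
  let D : Set (ℝ × (J → PointConfig)) := {p | a ≤ |∑ j, f ((p.2 j).shift p.1) - m|}
  have hD : MeasurableSet D := by
    refine measurableSet_le measurable_const (Measurable.abs (Measurable.sub_const ?_ m))
    refine Finset.measurable_fun_sum _ fun j _ => hf.comp ?_
    exact measurable_shift.comp
      (measurable_fst.prodMk ((measurable_pi_apply j).comp measurable_snd))
  have hc (x : ℝ) : P {ω | (x, Y ω) ∈ D} ≤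
      ENNReal.ofReal ((∑ j ∈ Finset.Icc 1 n, hatCDF P N j t) / a ^ 2) := by
    have h := measure_abs_sum_indicator_sub_le (P := P)
      (X := fun (j : J) ω => f ((N j ω).shift x))
      (fun j => hf.comp ((measurable_shift_const x).comp (hN' j).measurable))
      (fun j ω => hf01 _)
      ((hindep.precomp Subtype.val_injective).comp (fun _ φ => f (φ.shift x))
        fun _ => hf.comp (measurable_shift_const x)) ha
    simp_rw [hint] at h
    refine h.trans (ENNReal.ofReal_le_ofReal ?_)
    gcongr
    rw [hK]
    exact le_add_of_nonneg_left (hp0 i')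
  refine ⟨fun ω => ∫⁻ x in Ioc 0 1, D.indicator 1 (x, Y ω) ∂(N i ω).count, ?_, fun ω => ?_,
    lintegral_count_indep_le (hN' i').measurable hY hind hD hc⟩
  · exact measurable_setLIntegral_count (f := fun ω x => D.indicator 1 (x, Y ω)) (hN' i').measurable
      ((measurable_one.indicator hD).comp
        (measurable_snd.prodMk (hY.comp measurable_fst))) measurableSet_Ioc
  · refine le_of_le_of_eq ?_ (tsum_points _ _ measurableSet_Ioc fun x =>
      D.indicator (1 : ℝ × (J → PointConfig) → ℝ≥0∞) (x, Y ω))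
    refine ENNReal.tsum_le_tsum fun s => ?_
    -- Dropping content `i` changes the centred count by at most one, which costs the `+ 1`.
    have key : a + 1 ≤ |(distinctCount n (fun j => (N j ω).shift s) t : ℝ) -
        ∑ j ∈ Finset.Icc 1 n, hatCDF P N j t| → ((s : ℝ), Y ω) ∈ D := by
      intro h
      have hdc : (distinctCount n (fun j => (N j ω).shift s) t : ℝ) =
          f ((N i ω).shift s) + ∑ j : J, f ((N j ω).shift s) := by
        rw [distinctCount_eq_sum, ← hsplit fun j => f ((N j ω).shift s)]
        refine Finset.sum_congr rfl fun j _ => ?_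
        simp [f, B, indicator]
      rw [hdc, hK] at h
      change a ≤ |∑ j : J, f ((N j ω).shift s) - m|
      have h0 : 0 ≤ hatCDF P N i t := hp0 i'
      have h1 : hatCDF P N i t ≤ 1 := hp1 i'
      rcases hf01 ((N i ω).shift s) with hz | hz <;> rw [hz] at h <;>
      rcases le_abs.1 h with h | h <;> first
        | exact le_abs.2 (Or.inl (by linarith))
        | exact le_abs.2 (Or.inr (by linarith))
    by_cases hs : a + 1 ≤ |(distinctCount n (fun j => (N j ω).shift s) t : ℝ) -
        ∑ j ∈ Finset.Icc 1 n, hatCDF P N j t|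
    · simp [key hs, hs]
    · simp [hs]

/-- Comparison of the two hit probabilities in one system. -/
theorem abs_hitLRU_sub_hitTTL_le [IsProbabilityMeasure P]
    (hN : ∀ j, 1 ≤ j → j ≤ n → IsRequestProcess P (N j))
    (hindep : iIndepFun (fun j : Finset.Icc 1 n => N j) P) (hi : i ∈ Finset.Icc 1 n)
    {T₁ T T₂ C a K₁ K₂ : ℝ} (hT₁ : 0 ≤ T₁) (hT₁T : T₁ ≤ T) (hTT₂ : T ≤ T₂) (ha : 0 < a)
    (hK₁ : ∑ j ∈ Finset.Icc 1 n, hatCDF P N j T₁ = K₁)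
    (hK₂ : ∑ j ∈ Finset.Icc 1 n, hatCDF P N j T₂ = K₂)
    (hC₁ : K₁ + (a + 1) ≤ C) (hC₂ : C + (a + 1) ≤ K₂) :
    |hitLRU P N n C i - hitTTL P N T i| ≤
      interCDF P N i T₂ - interCDF P N i T₁ + K₂ / a ^ 2 := by
  have hM := hN i (Finset.mem_Icc.1 hi).1 (Finset.mem_Icc.1 hi).2
  have hmono := monotone_interCDF hM
  let A : Set (ℕ → PointConfig) := {ψ | (ψ i).RequestedWithin (fillTime n C ψ)}
  let B : ℝ → Set (ℕ → PointConfig) := fun t => {ψ | (ψ i).RequestedWithin t}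
  let E : ℝ → Set (ℕ → PointConfig) := fun t =>
    {ψ | a + 1 ≤ |(distinctCount n ψ t : ℝ) - ∑ j ∈ Finset.Icc 1 n, hatCDF P N j t|}
  -- If `Y(T₂) ≥ C` then `τ ≤ T₂`, and an LRU hit is a TTL hit with timer `T₂`. Otherwise `Y(T₂)`
  -- lies more than `a + 1` below its mean.
  have hA₂ : A ⊆ B T₂ ∪ E T₂ := by
    intro ψ hψ
    by_cases h : C ≤ distinctCount n ψ T₂
    · exact Or.inl (requestedWithin_mono _ (show fillTime n C ψ ≤ T₂ from
        sInf_le ⟨T₂, by linarith, h, rfl⟩) hψ)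
    · refine Or.inr ?_
      change a + 1 ≤ |_|
      refine le_abs.2 (Or.inr ?_)
      rw [hK₂]
      linarith
  -- If `Y(T₁) < C` then `τ ≥ T₁` because `Y` is monotone. Otherwise `Y(T₁)` exceeds its mean by at
  -- least `a + 1`.
  have hA₁ : B T₁ ⊆ A ∪ E T₁ := by
    intro ψ hψ
    by_cases h : C ≤ distinctCount n ψ T₁
    · refine Or.inr ?_
      change a + 1 ≤ |_|
      refine le_abs.2 (Or.inl ?_)
      rw [hK₁]
      linarith
    · refine Or.inl (requestedWithin_mono _ (le_sInf ?_) hψ)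
      rintro _ ⟨t, -, ht, rfl⟩
      by_contra! htT
      refine h (ht.trans ?_)
      exact_mod_cast distinctCount_mono n ψ htT.le
  have bound {A' B' : Set (ℕ → PointConfig)} {t K : ℝ} (ht : 0 ≤ t)
      (hK : ∑ j ∈ Finset.Icc 1 n, hatCDF P N j t = K) (hK0 : 0 ≤ K) (hAB : A' ⊆ B' ∪ E t) :
      palmProb P N i A' ≤ palmProb P N i B' + K / a ^ 2 := by
    obtain ⟨H, hHm, hHE, hH⟩ := exists_majorant_abs_distinctCount_sub hN hindep hi ht ha
    rw [hK] at hH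
    have h1 := palmExp_indicator_le_add (P := P) (B := B') hHm hHE hAB
    have h2 : (∫⁻ ω, H ω ∂P) / intensity P (N i) ≤ ENNReal.ofReal (K / a ^ 2) :=
      ENNReal.div_le_of_le_mul hH
    have h3 := h1.trans (add_le_add_right h2 _)
    have h4 := ENNReal.toReal_mono (ENNReal.add_ne_top.2
      ⟨(palmExp_indicator_lt_top hM _).ne, ENNReal.ofReal_ne_top⟩) h3
    rw [ENNReal.toReal_add (palmExp_indicator_lt_top hM _).ne ENNReal.ofReal_ne_top,
      ENNReal.toReal_ofReal (by positivity)] at h4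
    exact h4
  have hK₁0 : 0 ≤ K₁ := by
    rw [← hK₁]
    refine Finset.sum_nonneg fun j hj => ?_
    rw [← measureReal_requestedWithin (hN j (Finset.mem_Icc.1 hj).1 (Finset.mem_Icc.1 hj).2) hT₁]
    exact measureReal_nonneg
  have h₂ : hitLRU P N n C i ≤ hitTTL P N T₂ i + K₂ / a ^ 2 :=
    bound (by linarith) hK₂ (by linarith) hA₂
  have h₁ : hitTTL P N T₁ i ≤ hitLRU P N n C i + K₁ / a ^ 2 := bound hT₁ hK₁ hK₁0 hA₁
  have h12 : K₁ / a ^ 2 ≤ K₂ / a ^ 2 := by gcongr; linarith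
  rw [hitTTL_eq_interCDF hM] at h₁ h₂ ⊢
  have := hmono hT₁T
  have := hmono hTT₂
  rw [abs_le]
  constructor <;> linarith

end System

/-! ### Popularity tails, truncation of `Ψ`, modulus on the logarithmic scale -/

theorem sum_Icc_eq_sum_perm (n : ℕ) (σ : Equiv.Perm (Fin n)) (f : ℕ → ℝ) :
    ∑ j ∈ Finset.Icc 1 n, f j = ∑ l : Fin n, f (σ l + 1) := by
  rw [Equiv.sum_comp σ (fun l : Fin n => f (l + 1)), Fin.sum_univ_eq_sum_range (fun l => f (l + 1)),
    Finset.range_eq_Ico, Finset.sum_Ico_add' f 0 n 1]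
  rfl

/-- Bound `q` by 1 on the `k` most popular contents and by `c * p` on the others. -/
theorem sum_sub_le_mul_tailPopularity {p q : ℕ → ℝ} {n k : ℕ} {c : ℝ}
    (h1 : ∀ j ∈ Finset.Icc 1 n, q j ≤ 1) (hp : ∀ j ∈ Finset.Icc 1 n, q j ≤ c * p j) :
    ∑ j ∈ Finset.Icc 1 n, q j - k ≤ c * tailPopularity p n k := by
  rw [tailPopularity]
  set σ : Equiv.Perm (Fin n) := Tuple.sort (fun j : Fin n => -p (j + 1))
  have hσ (l : Fin n) : (σ l : ℕ) + 1 ∈ Finset.Icc 1 n :=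
    Finset.mem_Icc.2 ⟨by omega, (σ l).2⟩
  rw [sum_Icc_eq_sum_perm n σ q, Finset.mul_sum,
    ← Finset.sum_filter_add_sum_filter_not Finset.univ (fun l : Fin n => k ≤ (l : ℕ))]
  have hA : ∑ l ∈ Finset.univ.filter (fun l : Fin n => k ≤ (l : ℕ)), q (σ l + 1) ≤
      ∑ l ∈ Finset.univ.filter (fun l : Fin n => k ≤ (l : ℕ)), c * p (σ l + 1) :=
    Finset.sum_le_sum fun l _ => hp _ (hσ l)
  have hB : ∑ l ∈ Finset.univ.filter (fun l : Fin n => ¬ k ≤ (l : ℕ)), q (σ l + 1) ≤ k := by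
    refine (Finset.sum_le_card_nsmul _ _ 1 fun l _ => h1 _ (hσ l)).trans ?_
    have hcard : (Finset.univ.filter (fun l : Fin n => ¬ k ≤ (l : ℕ))).card ≤ k := by
      rw [← Finset.card_range k]
      refine Finset.card_le_card_of_injOn (fun l => (l : ℕ)) ?_ Fin.val_injective.injOn
      intro l hl
      simpa using hl
    simpa using hcard
  linarith

theorem tailPopularity_le_sum {p : ℕ → ℝ} {n k : ℕ} {b : ℝ}
    (hp : ∀ j ∈ Finset.Icc 1 n, 0 ≤ p j)
    (hk : ((Finset.Icc 1 n).filter fun j => b ≤ p j).card ≤ k) :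
    tailPopularity p n k ≤ ∑ j ∈ (Finset.Icc 1 n).filter (fun j => p j < b), p j := by
  rw [tailPopularity]
  set σ : Equiv.Perm (Fin n) := Tuple.sort (fun j : Fin n => -p (j + 1))
  have hmono : Monotone ((fun j : Fin n => -p (j + 1)) ∘ σ) := Tuple.monotone_sort _
  have hσ (l : Fin n) : (σ l : ℕ) + 1 ∈ Finset.Icc 1 n :=
    Finset.mem_Icc.2 ⟨by omega, (σ l).2⟩
  have hinj : Function.Injective fun l : Fin n => (σ l : ℕ) + 1 := fun l l' h =>
    σ.injective (Fin.ext (by simpa using h))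
  have hlt (l : Fin n) (hl : k ≤ (l : ℕ)) : p (σ l + 1) < b := by
    by_contra! hb
    -- If the content at position `l` reached `b`, so would all earlier ones, giving `l + 1 > k`
    -- such contents.
    have hcard : (Finset.Iic l).card ≤ ((Finset.Icc 1 n).filter fun j => b ≤ p j).card := by
      refine Finset.card_le_card_of_injOn (fun l : Fin n => (σ l : ℕ) + 1) ?_ hinj.injOn
      intro l' hl'
      have h := hmono (Finset.mem_Iic.1 hl')
      simp only [Function.comp_apply] at h
      exact Finset.mem_coe.2 (Finset.mem_filter.2 ⟨hσ l', by linarith⟩)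
    rw [Fin.card_Iic] at hcard
    omega
  rw [Finset.sum_filter, Finset.sum_filter, sum_Icc_eq_sum_perm n σ]
  refine Finset.sum_le_sum fun l _ => ?_
  split_ifs with h1 h2 h2
  · exact le_rfl
  · exact absurd (hlt l h1) h2
  · exact hp _ (hσ l)
  · exact le_rfl

/-- The mean is `∫ (1 - Ψ)` over the half-line, so a finite piece already exceeds `1 / κ`. Choosing
`a` so that some mass remains beyond it gives `Ψ(a) < 1`, and continuity leaves the margin `x₀`. -/
theorem exists_truncation {Ψ : Measure ℝ} [IsProbabilityMeasure Ψ] (hsupp : Ψ (Iio 0) = 0)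
    (hcont : Continuous (cdf Ψ)) {κ : ℝ} (hκ0 : 0 < κ) (hκ : 1 / κ < ∫ x, x ∂Ψ) :
    ∃ a > 0, ∃ x₀ > 0, 1 ≤ κ * ∫ z in (0 : ℝ)..a, (1 - cdf Ψ z) ∧ 0 < 1 - cdf Ψ (a * (1 + x₀)) := by
  have hκ' : 0 < 1 / κ := by positivity
  -- A non-integrable function would have integral 0, contradicting `hκ`.
  have hint : Integrable (fun x : ℝ => x) Ψ := by
    by_contra h
    rw [integral_undef h] at hκ
    linarith
  have h0 : 0 ≤ᵐ[Ψ] fun x : ℝ => x := by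
    rw [EventuallyLE, ae_iff]
    convert hsupp using 2
    ext x
    simp
  have hmean : ∫ x, x ∂Ψ = ∫ z in Ioi (0 : ℝ), (1 - cdf Ψ z) := by
    rw [hint.integral_eq_integral_meas_lt h0]
    refine integral_congr_ae (Eventually.of_forall fun z => ?_)
    have : {a : ℝ | z < a} = (Iic z)ᶜ := by ext; simp
    simp only [this, cdf_eq_real, probReal_compl_eq_one_sub measurableSet_Iic]
  have hI : IntegrableOn (fun z => 1 - cdf Ψ z) (Ioi 0) := by
    by_contra h
    rw [hmean, integral_undef h] at hκ
    linarith
  have hc : Continuous fun z => 1 - cdf Ψ z := continuous_const.sub hcont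
  have hF : Continuous fun b => ∫ z in (0 : ℝ)..b, (1 - cdf Ψ z) :=
    intervalIntegral.continuous_primitive (fun a b => hc.intervalIntegrable a b) 0
  have hlim := intervalIntegral_tendsto_integral_Ioi 0 hI tendsto_id
  rw [← hmean] at hlim
  -- The value `v` is strictly below the integral up to `b`; were `1 - Ψ` to vanish from `a` on, the
  -- two would agree.
  obtain ⟨v, hv1, hv2⟩ := exists_between hκ
  obtain ⟨b, hb, hb0⟩ := ((hlim.eventually_const_lt hv2).and (eventually_ge_atTop 0)).exists
  obtain ⟨a, ⟨ha0, hab⟩, hav⟩ := intermediate_value_Icc hb0 hF.continuousOn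
    (show v ∈ Icc _ _ by simpa using ⟨(hκ'.trans hv1).le, hb.le⟩)
  simp only [id] at hav hb
  have ha : 0 < a := by
    refine lt_of_le_of_ne ha0 fun h => ?_
    rw [← h, intervalIntegral.integral_same] at hav
    linarith
  have hpos : 0 < 1 - cdf Ψ a := by
    by_contra! hle
    have hsplit := intervalIntegral.integral_add_adjacent_intervals
      (hc.intervalIntegrable (μ := volume) 0 a) (hc.intervalIntegrable a b)
    have hz : ∫ z in a..b, (1 - cdf Ψ z) ≤ ∫ z in a..b, (0 : ℝ) := by
      refine intervalIntegral.integral_mono_on hab (hc.intervalIntegrable a b)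
        intervalIntegrable_const fun z hz => ?_
      linarith [monotone_cdf Ψ hz.1]
    simp only [intervalIntegral.integral_zero] at hz
    linarith
  have hcx : Continuous fun x => 1 - cdf Ψ (a * (1 + x)) := by fun_prop
  have hev : ∀ᶠ x in 𝓝[>] (0 : ℝ), 0 < 1 - cdf Ψ (a * (1 + x)) :=
    (hcx.continuousAt.eventually_const_lt (by simpa using hpos)).filter_mono nhdsWithin_le_nhds
  obtain ⟨x₀, hx₀, hx₀'⟩ := (hev.and self_mem_nhdsWithin).exists
  refine ⟨a, ha, x₀, hx₀', ?_, hx₀⟩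
  rw [hav]
  have := mul_lt_mul_of_pos_left hv1 hκ0
  rw [mul_one_div_cancel hκ0.ne'] at this
  exact this.le

/-- Uniform equicontinuity of cdfs with mean at most one is uniform on the logarithmic scale. -/
theorem exists_log_modulus {F : Set (ℝ → ℝ)} (hF : F.UniformEquicontinuous) {x₀ ε : ℝ} (hx₀ : 0 < x₀)
    (hε : 0 < ε) :
    ∃ x ∈ Ioo 0 1, x ≤ x₀ ∧ ∀ f ∈ F, Monotone f → (∀ z, f z ≤ 1) →
      (∀ z, 0 ≤ z → z * (1 - f z) ≤ 1) → ∀ u, 0 ≤ u → f (u * (1 + x)) - f (u * (1 - x)) ≤ ε := by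
  obtain ⟨δ, hδ, h⟩ := Metric.uniformEquicontinuous_iff.1 hF ε hε
  -- The bound `1 / 2` keeps `u(1 - x) ≥ u / 2` for large `u`; the bound `δ * ε / 8` makes `2 * u *
  -- x < δ` when `u ≤ 2 / ε`.
  refine ⟨min (1 / 2) (min x₀ (δ * ε / 8)), ⟨by positivity, by
    linarith [min_le_left (1 / 2) (min x₀ (δ * ε / 8))]⟩,
    (min_le_right _ _).trans (min_le_left _ _), ?_⟩
  set x := min (1 / 2) (min x₀ (δ * ε / 8))
  have hx0 : 0 < x := by positivity
  have hx1 : x ≤ 1 / 2 := min_le_left _ _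
  have hx2 : x ≤ δ * ε / 8 := (min_le_right _ _).trans (min_le_right _ _)
  intro f hf hmono hf1 hfm u hu
  by_cases hU : u * ε ≤ 2
  · have hd : dist (u * (1 + x)) (u * (1 - x)) < δ := by
      rw [Real.dist_eq, show u * (1 + x) - u * (1 - x) = 2 * u * x by ring, abs_of_nonneg (by positivity)]
      calc 2 * u * x ≤ 2 * u * (δ * ε / 8) := by gcongr
        _ = (u * ε) * δ / 4 := by ring
        _ ≤ 2 * δ / 4 := by gcongr
        _ < δ := by linarith
    have := h _ _ hd ⟨f, hf⟩
    exact (le_abs_self _).trans this.le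
  -- For `u > 2 / ε` the tail bound gives `1 - f (u(1 - x)) ≤ 2 / u < ε`, which dominates the
  -- increment.
  · have h1 := hfm (u * (1 - x)) (mul_nonneg hu (by linarith))
    have h2 := hf1 (u * (1 + x))
    have h3 : 0 ≤ 1 - f (u * (1 - x)) := by linarith [hf1 (u * (1 - x))]
    have h4 : u * (1 / 2) * (1 - f (u * (1 - x))) ≤ 1 := by
      refine le_trans ?_ h1
      gcongr
      linarith
    by_contra! hlt
    have h5 : ε < 1 - f (u * (1 - x)) := by linarith
    have hu' : 0 < u := by
      refine lt_of_le_of_ne hu fun h => hU ?_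
      rw [← h]
      norm_num
    have := mul_lt_mul_of_pos_left h5 hu'
    linarith

/-! ### Growth of the mean count around the characteristic time -/

section System

variable {Ω : Type*} [MeasurableSpace Ω] {P : Measure Ω} {N : ℕ → Ω → PointConfig} {i n : ℕ}

theorem intervalIntegrable_one_sub_interCDF (hM : IsRequestProcess P (N i)) (s t : ℝ) :
    IntervalIntegrable (fun z => 1 - interCDF P N i z) volume s t :=
  intervalIntegrable_const.sub (monotone_interCDF hM).intervalIntegrable

theorem hatCDF_zero : hatCDF P N i 0 = 0 := by
  simp [hatCDF]

theorem interCDF_nonneg (t : ℝ) : 0 ≤ interCDF P N i t := ENNReal.toReal_nonneg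

theorem one_sub_cdf_le {Ψ : Measure ℝ} (hM : IsRequestProcess P (N i))
    (hΨ : ∀ t : ℝ, 1 - stdCDF P N i t ≥ 1 - cdf Ψ t) (t : ℝ) :
    1 - cdf Ψ (rate P N i * t) ≤ 1 - interCDF P N i t := by
  have h := hΨ (rate P N i * t)
  rwa [stdCDF, mul_div_cancel_left₀ _ (rate_pos hM).ne'] at h

variable [IsProbabilityMeasure P]

theorem hatCDF_le_one (hM : IsRequestProcess P (N i)) {t : ℝ} (ht : 0 ≤ t) : hatCDF P N i t ≤ 1 := by
  rw [← measureReal_requestedWithin hM ht]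
  exact measureReal_le_one

theorem hatCDF_sub (hM : IsRequestProcess P (N i)) (s t : ℝ) :
    hatCDF P N i t - hatCDF P N i s = rate P N i * ∫ z in s..t, (1 - interCDF P N i z) := by
  rw [hatCDF_eq hM, hatCDF_eq hM, ← mul_sub, intervalIntegral.integral_interval_sub_left
    (intervalIntegrable_one_sub_interCDF hM _ _) (intervalIntegrable_one_sub_interCDF hM _ _)]

/-- The density `λ(1 - G)` of `Ĝ` is decreasing, hence at least its value at the right end. -/
theorem le_hatCDF_sub (hM : IsRequestProcess P (N i)) {s t : ℝ} (hst : s ≤ t) :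
    rate P N i * (t - s) * (1 - interCDF P N i t) ≤ hatCDF P N i t - hatCDF P N i s := by
  rw [hatCDF_sub hM, mul_assoc]
  refine mul_le_mul_of_nonneg_left ?_ (rate_pos hM).le
  have := intervalIntegral.integral_mono_on (μ := volume) hst
    (intervalIntegrable_const (c := 1 - interCDF P N i t))
    (intervalIntegrable_one_sub_interCDF hM s t)
    fun z hz => sub_le_sub_left (monotone_interCDF hM hz.2) 1
  rwa [intervalIntegral.integral_const, smul_eq_mul] at this

theorem hatCDF_sub_le (hM : IsRequestProcess P (N i)) {s t : ℝ} (hst : s ≤ t) :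
    hatCDF P N i t - hatCDF P N i s ≤ rate P N i * (t - s) * (1 - interCDF P N i s) := by
  rw [hatCDF_sub hM, mul_assoc]
  refine mul_le_mul_of_nonneg_left ?_ (rate_pos hM).le
  have := intervalIntegral.integral_mono_on (μ := volume) hst
    (intervalIntegrable_one_sub_interCDF hM s t)
    (intervalIntegrable_const (c := 1 - interCDF P N i s))
    fun z hz => sub_le_sub_left (monotone_interCDF hM hz.1) 1
  rwa [intervalIntegral.integral_const, smul_eq_mul] at this

theorem hatCDF_le_rate_mul (hM : IsRequestProcess P (N i)) {t : ℝ} (ht : 0 ≤ t) :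
    hatCDF P N i t ≤ rate P N i * t := by
  have h := hatCDF_sub_le hM ht
  rw [hatCDF_zero, sub_zero, sub_zero] at h
  refine h.trans (mul_le_of_le_one_right (mul_nonneg (rate_pos hM).le ht) ?_)
  linarith [interCDF_nonneg (P := P) (N := N) (i := i) 0]

theorem rate_mul_one_sub_le_hatCDF (hM : IsRequestProcess P (N i)) {t : ℝ} (ht : 0 ≤ t) :
    rate P N i * t * (1 - interCDF P N i t) ≤ hatCDF P N i t := by
  simpa [hatCDF_zero] using le_hatCDF_sub hM ht

/-- Rescaling time by the rate turns the domination by `Ψ` into a lower bound that depends on the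
content only through `λ t ≥ a`. -/
theorem integral_one_sub_cdf_le_hatCDF {Ψ : Measure ℝ} (hcont : Continuous (cdf Ψ))
    (hM : IsRequestProcess P (N i)) (hΨ : ∀ t : ℝ, 1 - stdCDF P N i t ≥ 1 - cdf Ψ t)
    {a t : ℝ} (ha : 0 ≤ a) (ht : 0 ≤ t) (hat : a ≤ rate P N i * t) :
    ∫ z in (0 : ℝ)..a, (1 - cdf Ψ z) ≤ hatCDF P N i t := by
  have hc : Continuous fun z => 1 - cdf Ψ z := continuous_const.sub hcont
  have hc' : Continuous fun z => 1 - cdf Ψ (rate P N i * z) :=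
    hc.comp (continuous_const.mul continuous_id)
  calc ∫ z in (0 : ℝ)..a, (1 - cdf Ψ z)
      ≤ ∫ z in (0 : ℝ)..(rate P N i * t), (1 - cdf Ψ z) := by
        refine intervalIntegral.integral_mono_interval le_rfl ha hat
          (Eventually.of_forall fun z => ?_) (hc.intervalIntegrable _ _)
        exact sub_nonneg.2 (cdf_le_one Ψ z)
    _ = rate P N i * ∫ z in (0 : ℝ)..t, (1 - cdf Ψ (rate P N i * z)) := by
        rw [intervalIntegral.mul_integral_comp_mul_left (f := fun z => 1 - cdf Ψ z), mul_zero]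
    _ ≤ hatCDF P N i t := by
        rw [hatCDF_eq hM]
        refine mul_le_mul_of_nonneg_left ?_ (rate_pos hM).le
        exact intervalIntegral.integral_mono_on ht (hc'.intervalIntegrable _ _)
          (intervalIntegrable_one_sub_interCDF hM _ _) fun z _ => one_sub_cdf_le hM hΨ z

/-- Contents of moderate popularity carry a positive fraction of the cache size. -/
theorem mul_le_sum_moderate (hN : ∀ j ∈ Finset.Icc 1 n, IsRequestProcess P (N j)) (hn : 1 ≤ n)
    {Ψ : Measure ℝ} (hcont : Continuous (cdf Ψ))
    (hΨ : ∀ j ∈ Finset.Icc 1 n, ∀ t : ℝ, 1 - stdCDF P N j t ≥ 1 - cdf Ψ t)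
    {C T κ₁ κ₂ γ a : ℝ} (hC : 0 ≤ C) (hT : 0 < T) (hCT : C = ∑ j ∈ Finset.Icc 1 n, hatCDF P N j T)
    (ha : 0 < a) (hκ₁ : 0 ≤ κ₁) (hκa : 1 ≤ κ₁ * ∫ z in (0 : ℝ)..a, (1 - cdf Ψ z))
    (hκ₂ : 0 ≤ κ₂) (hγ : 0 ≤ γ)
    (hP1 : tailPopularity (popularity P N n) n ⌈κ₁ * C⌉₊
        > γ * tailPopularity (popularity P N n) n ⌊κ₂ * C⌋₊) :
    γ * (1 - κ₂) * C ≤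
      ∑ j ∈ (Finset.Icc 1 n).filter (fun j => rate P N j * T < a), rate P N j * T := by
  set S := ∑ j ∈ Finset.Icc 1 n, rate P N j with hS
  have hSpos : 0 < S := Finset.sum_pos (fun j hj => rate_pos (hN j hj)) ⟨1, by simpa using hn⟩
  have hST : 0 < S * T := by positivity
  have hpop (j : ℕ) : S * T * popularity P N n j = rate P N j * T := by
    rw [popularity, ← hS]
    field_simp
  have hlt (j : ℕ) : popularity P N n j < a / (S * T) ↔ rate P N j * T < a := by
    rw [lt_div_iff₀ hST, mul_comm, hpop]
  -- Outside the `⌊κ₂ C⌋` most popular contents use `Ĝ_j(T) ≤ λ_j T = S T p_j`; this bounds `C - ⌊κ₂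
  -- C⌋` by a tail.
  have h2 := sum_sub_le_mul_tailPopularity (p := popularity P N n) (q := fun j => hatCDF P N j T)
    (n := n) (k := ⌊κ₂ * C⌋₊) (c := S * T) (fun j hj => hatCDF_le_one (hN j hj) hT.le)
    fun j hj => by rw [hpop]; exact hatCDF_le_rate_mul (hN j hj) hT.le
  rw [← hCT] at h2
  have h2' : (⌊κ₂ * C⌋₊ : ℝ) ≤ κ₂ * C := Nat.floor_le (by positivity)
  -- Each content with `λ_j T ≥ a` adds at least `1 / κ₁` to a sum equal to `C`.
  have hcard : ((Finset.Icc 1 n).filter fun j => a / (S * T) ≤ popularity P N n j).card ≤ ⌈κ₁ * C⌉₊ := by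
    set J := (Finset.Icc 1 n).filter fun j => a / (S * T) ≤ popularity P N n j
    have hJ : (J.card : ℝ) * ∫ z in (0 : ℝ)..a, (1 - cdf Ψ z) ≤ C := by
      rw [← nsmul_eq_mul]
      calc J.card • ∫ z in (0 : ℝ)..a, (1 - cdf Ψ z) ≤ ∑ j ∈ J, hatCDF P N j T := by
            refine Finset.card_nsmul_le_sum _ _ _ fun j hj => ?_
            obtain ⟨hj, hj'⟩ := Finset.mem_filter.1 hj
            exact integral_one_sub_cdf_le_hatCDF hcont (hN j hj) (hΨ j hj) ha.le hT.le
              (not_lt.1 fun h => absurd ((hlt j).2 h) (not_lt.2 hj'))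
        _ ≤ C := by
            rw [hCT]
            refine Finset.sum_le_sum_of_subset_of_nonneg (Finset.filter_subset _ _) fun j hj _ => ?_
            rw [← measureReal_requestedWithin (hN j hj) hT.le]
            exact measureReal_nonneg
    have : (J.card : ℝ) ≤ κ₁ * C := by
      calc (J.card : ℝ) ≤ J.card * (κ₁ * ∫ z in (0 : ℝ)..a, (1 - cdf Ψ z)) :=
            le_mul_of_one_le_right (by positivity) hκa
        _ = κ₁ * (J.card * ∫ z in (0 : ℝ)..a, (1 - cdf Ψ z)) := by ring
        _ ≤ κ₁ * C := by gcongr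
    exact_mod_cast this.trans (Nat.le_ceil _)
  have h1 := tailPopularity_le_sum (p := popularity P N n)
    (fun j hj => div_nonneg (rate_pos (hN j hj)).le hSpos.le) hcard
  calc γ * (1 - κ₂) * C ≤ γ * (C - ⌊κ₂ * C⌋₊) := by
        rw [mul_assoc]
        gcongr
        linarith
    _ ≤ γ * (S * T * tailPopularity (popularity P N n) n ⌊κ₂ * C⌋₊) := by gcongr
    _ = S * T * (γ * tailPopularity (popularity P N n) n ⌊κ₂ * C⌋₊) := by ring
    _ ≤ S * T * tailPopularity (popularity P N n) n ⌈κ₁ * C⌉₊ := by gcongr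
    _ ≤ S * T * ∑ j ∈ (Finset.Icc 1 n).filter (fun j => popularity P N n j < a / (S * T)),
          popularity P N n j := by gcongr
    _ = _ := by
        rw [Finset.mul_sum]
        simp_rw [hpop, hlt]

/-- A relative change `x` of the timer moves the mean count by at least `δ * C`, whereas its
fluctuations are of order `√C`. -/
theorem abs_hitLRU_sub_hitTTL_le_of_popularity
    (hN : ∀ j, 1 ≤ j → j ≤ n → IsRequestProcess P (N j))
    (hindep : iIndepFun (fun j : Finset.Icc 1 n => N j) P) (hi : i ∈ Finset.Icc 1 n)
    {Ψ : Measure ℝ} (hcont : Continuous (cdf Ψ))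
    (hΨ : ∀ j ∈ Finset.Icc 1 n, ∀ t : ℝ, 1 - stdCDF P N j t ≥ 1 - cdf Ψ t)
    {C T κ₁ κ₂ γ a x x₀ δ : ℝ} (hC : 0 < C) (hT : IsCharacteristicTime P N n C T)
    (ha : 0 < a) (hκ₁ : 0 ≤ κ₁) (hκa : 1 ≤ κ₁ * ∫ z in (0 : ℝ)..a, (1 - cdf Ψ z))
    (hx : x ∈ Ioo 0 1) (hxx₀ : x ≤ x₀)
    (hκ₂ : 0 ≤ κ₂) (hγ : 0 ≤ γ) (hax₀ : 0 ≤ 1 - cdf Ψ (a * (1 + x₀)))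
    (hδ : δ = x * (1 - cdf Ψ (a * (1 + x₀))) * (γ * (1 - κ₂))) (hδC : 2 < δ * C)
    (hP1 : tailPopularity (popularity P N n) n ⌈κ₁ * C⌉₊
        > γ * tailPopularity (popularity P N n) n ⌊κ₂ * C⌋₊) :
    |hitLRU P N n C i - hitTTL P N T i| ≤
      interCDF P N i (T * (1 + x)) - interCDF P N i (T * (1 - x)) + 8 / (δ ^ 2 * C) := by
  obtain ⟨hT0, hCT⟩ := hT
  obtain ⟨hx0, hx1⟩ := hx
  have hTpos : 0 < T := by
    refine lt_of_le_of_ne hT0 fun h => hC.ne' ?_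
    rw [hCT, ← h]
    exact Finset.sum_eq_zero fun j _ => hatCDF_zero
  have hN' (j) (hj : j ∈ Finset.Icc 1 n) : IsRequestProcess P (N j) :=
    hN j (Finset.mem_Icc.1 hj).1 (Finset.mem_Icc.1 hj).2
  have hn : 1 ≤ n := (Finset.mem_Icc.1 hi).1.trans (Finset.mem_Icc.1 hi).2
  have hmod := mul_le_sum_moderate hN' hn hcont hΨ hC.le hTpos hCT ha hκ₁ hκa hκ₂ hγ hP1
  set d := 1 - cdf Ψ (a * (1 + x₀)) with hd
  -- Keep only the contents with `λ_j T < a`: for them `λ_j t ≤ a(1 + x₀)`, so `1 - G_j(t) ≥ d`.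
  have hgain (t : ℝ) (ht : t ≤ T * (1 + x)) :
      δ * C ≤ ∑ j ∈ Finset.Icc 1 n, rate P N j * (T * x) * (1 - interCDF P N j t) := by
    calc δ * C = x * d * (γ * (1 - κ₂) * C) := by rw [hδ]; ring
      _ ≤ x * d * ∑ j ∈ (Finset.Icc 1 n).filter (fun j => rate P N j * T < a), rate P N j * T := by
        gcongr
      _ ≤ ∑ j ∈ (Finset.Icc 1 n).filter (fun j => rate P N j * T < a),
            rate P N j * (T * x) * (1 - interCDF P N j t) := by
        rw [Finset.mul_sum]
        refine Finset.sum_le_sum fun j hj => ?_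
        obtain ⟨hj, hja⟩ := Finset.mem_filter.1 hj
        have hr := rate_pos (hN' j hj)
        have h1 : d ≤ 1 - interCDF P N j t := by
          refine le_trans (sub_le_sub_left (monotone_cdf Ψ ?_) 1) (one_sub_cdf_le (hN' j hj) (hΨ j hj) t)
          calc rate P N j * t ≤ rate P N j * (T * (1 + x)) := by gcongr
            _ = rate P N j * T * (1 + x) := by ring
            _ ≤ a * (1 + x₀) := by gcongr
        calc x * d * (rate P N j * T) = rate P N j * (T * x) * d := by ring
          _ ≤ _ := by gcongr
      _ ≤ _ := by
        refine Finset.sum_le_sum_of_subset_of_nonneg (Finset.filter_subset _ _) fun j hj _ => ?_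
        have hr := rate_pos (hN' j hj)
        have := interCDF_le_one (hN' j hj) t
        exact mul_nonneg (by positivity) (by linarith)
  have hT₁ : 0 ≤ T * (1 - x) := mul_nonneg hT0 (by linarith)
  have hT₁T : T * (1 - x) ≤ T := mul_le_of_le_one_right hT0 (by linarith)
  have hTT₂ : T ≤ T * (1 + x) := le_mul_of_one_le_right hT0 (by linarith)
  have hlow : ∑ j ∈ Finset.Icc 1 n, hatCDF P N j (T * (1 - x)) + δ * C ≤ C := by
    have h : ∑ j ∈ Finset.Icc 1 n, rate P N j * (T * x) * (1 - interCDF P N j T) ≤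
        ∑ j ∈ Finset.Icc 1 n, (hatCDF P N j T - hatCDF P N j (T * (1 - x))) := by
      refine Finset.sum_le_sum fun j hj => ?_
      have := le_hatCDF_sub (hN' j hj) hT₁T
      rwa [show T - T * (1 - x) = T * x by ring] at this
    rw [Finset.sum_sub_distrib, ← hCT] at h
    linarith [hgain T hTT₂]
  have hup : C + δ * C ≤ ∑ j ∈ Finset.Icc 1 n, hatCDF P N j (T * (1 + x)) := by
    have h : ∑ j ∈ Finset.Icc 1 n, rate P N j * (T * x) * (1 - interCDF P N j (T * (1 + x))) ≤
        ∑ j ∈ Finset.Icc 1 n, (hatCDF P N j (T * (1 + x)) - hatCDF P N j T) := by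
      refine Finset.sum_le_sum fun j hj => ?_
      have := le_hatCDF_sub (hN' j hj) hTT₂
      rwa [show T * (1 + x) - T = T * x by ring] at this
    rw [Finset.sum_sub_distrib, ← hCT] at h
    linarith [hgain (T * (1 + x)) le_rfl]
  -- By concavity of `Ĝ_j` and `x < 1`, its increment beyond `T` is at most `Ĝ_j(T)`.
  have hup' : ∑ j ∈ Finset.Icc 1 n, hatCDF P N j (T * (1 + x)) ≤ 2 * C := by
    have h : ∑ j ∈ Finset.Icc 1 n, (hatCDF P N j (T * (1 + x)) - hatCDF P N j T) ≤
        ∑ j ∈ Finset.Icc 1 n, hatCDF P N j T := by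
      refine Finset.sum_le_sum fun j hj => ?_
      have h1 := hatCDF_sub_le (hN' j hj) hTT₂
      rw [show T * (1 + x) - T = T * x by ring] at h1
      have h2 := rate_mul_one_sub_le_hatCDF (hN' j hj) hT0
      have h3 : 0 ≤ hatCDF P N j T := by
        refine le_trans (mul_nonneg (mul_nonneg (rate_pos (hN' j hj)).le hT0) ?_) h2
        linarith [interCDF_le_one (hN' j hj) T]
      calc _ ≤ _ := h1
        _ = x * (rate P N j * T * (1 - interCDF P N j T)) := by ring
        _ ≤ x * hatCDF P N j T := by gcongr
        _ ≤ hatCDF P N j T := mul_le_of_le_one_left h3 hx1.le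
    rw [Finset.sum_sub_distrib, ← hCT] at h
    linarith
  have hδpos : 0 < δ := pos_of_mul_pos_left (by linarith) hC.le
  -- With `a = δ C / 2`, the condition `δ C > 2` gives `a + 1 ≤ δ C`, the gap available on both
  -- sides.
  refine (abs_hitLRU_sub_hitTTL_le hN hindep hi hT₁ hT₁T hTT₂ (a := δ * C / 2) (by linarith) rfl rfl
    (by linarith) (by linarith)).trans ?_
  refine add_le_add_right ?_ _
  calc _ ≤ 2 * C / (δ * C / 2) ^ 2 := by gcongr
    _ = 8 / (δ ^ 2 * C) := by field_simp; norm_num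

end System

/-! ### Convergence of the hit probabilities -/

/-- Uniform convergence over all contents whose standardized cdf lies in an equicontinuous family. -/
theorem eventually_abs_hitLRU_sub_hitTTL_le {Ω : Type*} [MeasurableSpace Ω] {P : Measure Ω}
    [IsProbabilityMeasure P] {N : ℕ → ℕ → Ω → PointConfig}
    (hN : ∀ n i, 1 ≤ i → i ≤ n → IsRequestProcess P (N n i))
    (hindep : ∀ n, iIndepFun (fun i : Finset.Icc 1 n => N n i) P)
    {Ψ : Measure ℝ} [IsProbabilityMeasure Ψ]
    (hΨsupp : Ψ (Set.Iio 0) = 0) (hΨcont : Continuous (cdf Ψ)) (hΨmean : 0 < ∫ x, x ∂Ψ)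
    (hΨ : ∀ n i, 1 ≤ i → i ≤ n → ∀ t : ℝ, 1 - stdCDF P (N n) i t ≥ 1 - cdf Ψ t)
    {C T : ℕ → ℝ} (hC : Tendsto C atTop atTop)
    (hT : ∀ᶠ n in atTop, IsCharacteristicTime P (N n) n (C n) (T n))
    {κ₁ κ₂ γ : ℝ} (hκ₁ : 1 / ∫ x, x ∂Ψ < κ₁) (hκ₂ : κ₂ ∈ Set.Ico (0 : ℝ) 1) (hγ : 0 < γ)
    (hP1 : ∀ᶠ n in atTop,
      tailPopularity (popularity P (N n) n) n ⌈κ₁ * C n⌉₊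
        > γ * tailPopularity (popularity P (N n) n) n ⌊κ₂ * C n⌋₊)
    {F : Set (ℝ → ℝ)} (hF : F.UniformEquicontinuous) {ε : ℝ} (hε : 0 < ε) :
    ∀ᶠ n in atTop, ∀ i, 1 ≤ i → i ≤ n → stdCDF P (N n) i ∈ F →
      |hitLRU P (N n) n (C n) i - hitTTL P (N n) (T n) i| ≤ ε := by
  have hκ₁pos : 0 < κ₁ := (one_div_pos.2 hΨmean).trans hκ₁
  -- Here `a` and `x₀` depend only on `Ψ` and `κ₁`, and `x` in addition on `F` and `ε`. Hence `δ` is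
  -- independent of `n` and `i`.
  obtain ⟨a, ha, x₀, hx₀, hκa, hd⟩ := exists_truncation hΨsupp hΨcont hκ₁pos
    ((one_div_lt hκ₁pos hΨmean).2 hκ₁)
  obtain ⟨x, hx, hxx₀, hmod⟩ := exists_log_modulus hF hx₀ (half_pos hε)
  set δ := x * (1 - cdf Ψ (a * (1 + x₀))) * (γ * (1 - κ₂)) with hδ
  have hδpos : 0 < δ := mul_pos (mul_pos hx.1 hd) (mul_pos hγ (by linarith [hκ₂.2]))
  filter_upwards [hT, hP1, hC.eventually_gt_atTop 0, hC.eventually_gt_atTop (2 / δ),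
    hC.eventually_ge_atTop (16 / (δ ^ 2 * ε))] with n hTn hPn hC0 hC1 hC2 i hi hin hFi
  have hM := hN n i hi hin
  have hr := rate_pos hM
  have hmain := abs_hitLRU_sub_hitTTL_le_of_popularity (hN n) (hindep n) (Finset.mem_Icc.2 ⟨hi, hin⟩)
    hΨcont (fun j hj => hΨ n j (Finset.mem_Icc.1 hj).1 (Finset.mem_Icc.1 hj).2) hC0 hTn ha hκ₁pos.le
    hκa hx hxx₀ hκ₂.1 hγ.le hd.le hδ (by rw [div_lt_iff₀ hδpos] at hC1; linarith) hPn
  have hstd (t : ℝ) : stdCDF P (N n) i (rate P (N n) i * t) = interCDF P (N n) i t := by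
    rw [stdCDF, mul_div_cancel_left₀ _ hr.ne']
  -- The tail bound for `G*_i` at `z` is `λ t (1 - G_i(t)) ≤ Ĝ_i(t) ≤ 1` at `t = z / λ`; the modulus
  -- is then used at `u = λ T`.
  have hlog := hmod _ hFi
    (fun s t hst => monotone_interCDF hM (div_le_div_of_nonneg_right hst hr.le))
    (fun z => interCDF_le_one hM _) (fun z hz => by
      have h1 := rate_mul_one_sub_le_hatCDF hM (div_nonneg hz hr.le)
      rw [mul_div_cancel₀ _ hr.ne'] at h1
      exact h1.trans (hatCDF_le_one hM (div_nonneg hz hr.le)))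
    (rate P (N n) i * T n) (mul_nonneg hr.le hTn.1)
  rw [mul_assoc, mul_assoc, hstd, hstd] at hlog
  have htail : 8 / (δ ^ 2 * C n) ≤ ε / 2 := by
    rw [div_le_iff₀ (by positivity)] at hC2 ⊢
    linarith
  linarith

end RequestModel
theorem mainTheorem1 {Ω : Type*} [MeasurableSpace Ω] (P : Measure Ω) [IsProbabilityMeasure P]
    -- `N n i` is the request process of content `i` (`1 ≤ i ≤ n`) in the `n`-th system
    (N : ℕ → ℕ → Ω → PointConfig)
    (hN : ∀ n i, 1 ≤ i → i ≤ n → IsRequestProcess P (N n i))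
    (hindep : ∀ n, iIndepFun (fun i : Finset.Icc 1 n => N n i) P)
    (hcont : ∀ n i, 1 ≤ i → i ≤ n → Continuous (interCDF P (N n) i))
    -- the dominating distribution `Ψ`, with cdf `cdf Ψ` and mean `∫ x, x ∂Ψ`
    (Ψ : Measure ℝ) [IsProbabilityMeasure Ψ]
    (hΨsupp : Ψ (Set.Iio 0) = 0) (hΨcont : Continuous (cdf Ψ)) (hΨmean : 0 < ∫ x, x ∂Ψ)
    (hΨ : ∀ n i, 1 ≤ i → i ≤ n → ∀ t : ℝ, 1 - stdCDF P (N n) i t ≥ 1 - cdf Ψ t)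
    -- cache sizes and characteristic times
    (C T : ℕ → ℝ) (hC : Tendsto C atTop atTop)
    (hT : ∀ᶠ n in atTop, IsCharacteristicTime P (N n) n (C n) (T n))
    -- (C1)
    (β₁ : ℝ) (hβ₁ : β₁ ∈ Set.Ioo 0 (∫ x, x ∂Ψ)) (hC1 : ∀ᶠ n : ℕ in atTop, C n ≤ β₁ * n)
    -- (P1)
    (κ₁ κ₂ γ : ℝ) (hκ₁ : κ₁ ∈ Set.Ioo (1 / ∫ x, x ∂Ψ) (1 / β₁)) (hκ₂ : κ₂ ∈ Set.Ico (0 : ℝ) 1)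
    (hγ : γ ∈ Set.Ioo (0 : ℝ) 1)
    (hP1 : ∀ᶠ n in atTop,
      tailPopularity (popularity P (N n) n) n ⌈κ₁ * C n⌉₊
        > γ * tailPopularity (popularity P (N n) n) n ⌊κ₂ * C n⌋₊) :
    -- under (R1) for content `i`
    (∀ i, 1 ≤ i → (stdFamilyOf P N i).UniformEquicontinuous →
      Tendsto (fun n => |hitLRU P (N n) n (C n) i - hitTTL P (N n) (T n) i|) atTop (𝓝 0)) ∧
    -- under (R2)
    ((stdFamily P N).UniformEquicontinuous →
      Tendsto (fun n => ⨆ i : Finset.Icc 1 n,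
        |hitLRU P (N n) n (C n) i - hitTTL P (N n) (T n) i|) atTop (𝓝 0)) := by
  -- One bound serves both claims, with `F` the family of a single content or that of all contents.
  have hunif {F : Set (ℝ → ℝ)} (hF : F.UniformEquicontinuous) {ε : ℝ} (hε : 0 < ε) :=
    eventually_abs_hitLRU_sub_hitTTL_le hN hindep hΨsupp hΨcont hΨmean hΨ hC hT hκ₁.1 hκ₂ hγ.1
      hP1 hF hε
  refine ⟨fun i hi hF => ?_, fun hF => ?_⟩
  · rw [Metric.tendsto_atTop']
    intro ε hε
    obtain ⟨n₀, hn₀⟩ := eventually_atTop.1 (hunif hF (half_pos hε))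
    refine ⟨max n₀ i, fun n hn => ?_⟩
    have hin : i ≤ n := (le_max_right _ _).trans hn.le
    have h := hn₀ n ((le_max_left _ _).trans hn.le) i hi hin ⟨n, hin, rfl⟩
    rw [Real.dist_eq, sub_zero, abs_abs]
    linarith
  · rw [Metric.tendsto_atTop']
    intro ε hε
    obtain ⟨n₀, hn₀⟩ := eventually_atTop.1 (hunif hF (half_pos hε))
    refine ⟨n₀, fun n hn => ?_⟩
    have h : (⨆ i : Finset.Icc 1 n,
        |hitLRU P (N n) n (C n) i - hitTTL P (N n) (T n) i|) ≤ ε / 2 := by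
      refine Real.iSup_le (fun i => ?_) (half_pos hε).le
      obtain ⟨hi, hin⟩ := Finset.mem_Icc.1 i.2
      exact hn₀ n hn.le i hi hin (mem_biUnion (show (i : ℕ) ∈ Ici 1 from hi) ⟨n, hin, rfl⟩)
    rw [Real.dist_eq, sub_zero, abs_of_nonneg (Real.iSup_nonneg fun i => abs_nonneg _)]
    linarith
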